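/- Let $K$ be a field of characteristic $0$ and let $n,m\ge 0$. For an ideal $L$ of a polynomial ring $K[z_1,\dots,z_r]$, let $\mathrm{in}(L)$ be the ideal generated by the initial terms of the elements of $L$ with respect to the degree reverse lexicographic order induced by $z_1>\dots>z_r$. An ideal $G$ is the generic initial ideal of $L$ if there is a nonempty Zariski open set $U\subseteq \mathrm{GL}_r(K)$ such that $\mathrm{in}(\varphi(L))=G$ for all $\varphi\in U$, where $\mathrm{GL}_r(K)$ acts on $K[z_1,\dots,z_r]$ by linear changes of coordinates; such a $G$ is unique. Let $I\subset K[x_1,\dots,x_n]$ and $J\subset K[x_{n+1},\dots,x_{n+m}]$ be graded ideals. Let $\mathrm{gin}_n(I)$ and $\mathrm{gin}_m(J)$ be their generic initial ideals in these two rings, with respect to $x_1>\dots>x_n$ and $x_{n+1}>\dots>x_{n+m}$ respectively, and let $\mathrm{gin}$ denote the generic initial ideal in $S=K[x_1,\dots,x_{n+m}]$ with respect to $x_1>\dots>x_{n+m}$. For ideals $A\subset K[x_1,\dots,x_n]$ and $B\subset K[x_{n+1},\dots,x_{n+m}]$ let $F(A,B)=AS+BS+Q\subset S$, where $Q=(x_1,\dots,x_n)(x_{n+1},\dots,x_{n+m})$.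 Then all generic initial ideals in the following formula exist, and $$\mathrm{gin}(F(I,J))=\mathrm{gin}\bigl(F(\mathrm{gin}_n(I),\mathrm{gin}_m(J))\bigr).$$ -/

import Mathlib

open MvPolynomial

attribute [local instance] MvPolynomial.gradedAlgebra

/-! ### The degree reverse lexicographic order -/

/-- Exponent vectors, to be equipped with the degree reverse lexicographic order. -/
def DegRevLex (σ : Type*) : Type _ := σ →₀ ℕ

namespace DegRevLex

variable {σ : Type*}

noncomputable instance : AddCommMonoid (DegRevLex σ) :=
  inferInstanceAs (AddCommMonoid (σ →₀ ℕ))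

/-- The tautological identification of exponent vectors with their type synonym. -/
noncomputable def of : (σ →₀ ℕ) ≃+ DegRevLex σ := AddEquiv.refl _

/-- The key by which exponent vectors are compared: first the total degree, then the *dual* of the
colexicographic order. -/
noncomputable def key (a : DegRevLex σ) : ℕ ×ₗ (Colex (σ →₀ ℕ))ᵒᵈ :=
  toLex ((of.symm a).degree, OrderDual.toDual (toColex (of.symm a)))

theorem key_injective : Function.Injective (key (σ := σ)) := by
  intro a b h
  have h2 := congrArg (fun x => ofColex (OrderDual.ofDual (ofLex x).2)) h
  exact of.symm.injective h2

/-- The degree reverse lexicographic order, see `DegRevLex.lt_iff` for the explicit form. -/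
noncomputable instance [LinearOrder σ] : LinearOrder (DegRevLex σ) :=
  LinearOrder.lift' key key_injective

/-- `x^a < x^b` in the degree reverse lexicographic order (with `x_i > x_j` for `i < j`) iff
`deg x^a < deg x^b`, or the degrees agree and at the last index where the exponents differ
the exponent of `x^a` is the larger one. -/
theorem lt_iff [LinearOrder σ] {a b : σ →₀ ℕ} :
    of a < of b ↔ a.degree < b.degree ∨
      (a.degree = b.degree ∧ ∃ i, (∀ j, i < j → a j = b j) ∧ b i < a i) := by
  change key (of a) < key (of b) ↔ _
  rw [key, key, Prod.Lex.toLex_lt_toLex]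
  simp only [AddEquiv.symm_apply_apply, OrderDual.toDual_lt_toDual, Finsupp.Colex.lt_iff]
  simp only [ofColex_toColex, eq_comm]

theorem le_iff [LinearOrder σ] {a b : DegRevLex σ} :
    a ≤ b ↔ (of.symm a).degree < (of.symm b).degree ∨
      ((of.symm a).degree = (of.symm b).degree ∧
        toColex (of.symm b) ≤ toColex (of.symm a)) := by
  change key a ≤ key b ↔ _
  rw [key, key, Prod.Lex.toLex_le_toLex]
  simp only [OrderDual.toDual_le_toDual]

instance [LinearOrder σ] : IsOrderedAddMonoid (DegRevLex σ) where
  add_le_add_left a b h c := by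
    rw [le_iff] at h ⊢
    simpa [map_add, toColex_add] using h

instance [LinearOrder σ] [Finite σ] : WellFoundedLT (DegRevLex σ) := by
  have hfin : ∀ a : DegRevLex σ, (Set.Iio a).Finite := fun a =>
    (Finsupp.finite_of_degree_le (σ := σ) (of.symm a).degree).subset fun b hb => by
      rcases le_iff.1 (le_of_lt hb) with h | h
      · exact h.le
      · exact h.1.le
  have hmono : StrictMono fun a : DegRevLex σ => (Set.Iio a).ncard := fun a b hab =>
    Set.ncard_lt_ncard (Set.Iio_ssubset_Iio hab) (hfin b)
  exact hmono.wellFoundedLT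

end DegRevLex

/-- The degree reverse lexicographic order as a monomial order. -/
noncomputable def degRevLex (σ : Type*) [LinearOrder σ] [Finite σ] : MonomialOrder σ where
  syn := DegRevLex σ
  toSyn := DegRevLex.of
  toSyn_monotone a b h := by
    rw [DegRevLex.le_iff]
    simp only [AddEquiv.symm_apply_apply]
    rcases (Finsupp.degree_mono h).lt_or_eq with hd | hd
    · exact Or.inl hd
    · have : a = b := by
        have h1 : (b - a).degree = 0 := by
          have := congrArg Finsupp.degree (add_tsub_cancel_of_le h)
          rw [map_add] at this
          omega
        rw [Finsupp.degree_eq_zero_iff] at h1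
        rw [← add_tsub_cancel_of_le h, h1, add_zero]
      subst this
      exact Or.inr ⟨rfl, le_rfl⟩

/-! ### Initial ideals and generic initial ideals -/

section Gin

variable {K : Type*} [Field K] {n : ℕ}

/-- The initial ideal `in(I)` with respect to the degree reverse lexicographic order
induced by `x_1 > ⋯ > x_n`. -/
noncomputable def initialIdeal (I : Ideal (MvPolynomial (Fin n) K)) :
    Ideal (MvPolynomial (Fin n) K) :=
  Ideal.span ((degRevLex (Fin n)).leadingTerm '' (I : Set (MvPolynomial (Fin n) K)))

/-- The linear change of coordinates `x_j ↦ ∑ i, A i j * x_i` given by `A ∈ GL_n(K)`. -/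
noncomputable def linearChange (A : GL (Fin n) K) :
    MvPolynomial (Fin n) K →ₐ[K] MvPolynomial (Fin n) K :=
  aeval fun j => ∑ i, C (A i j) * X i

/-- `G` is the generic initial ideal of `I`: `in(φ(I)) = G` for all `φ` in some nonempty
Zariski open subset of `GL_n(K)`. (For infinite `K`, every nonempty Zariski open subset of `GL_n(K)`
contains a nonempty one of the form `{A | P(A) ≠ 0}` with `P ≠ 0` a polynomial
in the `n²` matrix entries.) -/
def IsGin (I G : Ideal (MvPolynomial (Fin n) K)) : Prop :=
  ∃ P : MvPolynomial (Fin n × Fin n) K, P ≠ 0 ∧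
    ∀ A : GL (Fin n) K, eval (fun p => A p.1 p.2) P ≠ 0 →
      initialIdeal (I.map (linearChange A)) = G

/-- Over an infinite field there is at most one generic initial ideal. -/
theorem IsGin.unique [Infinite K] {I G G' : Ideal (MvPolynomial (Fin n) K)}
    (h : IsGin I G) (h' : IsGin I G') : G = G' := by
  obtain ⟨P, hP, hG⟩ := h
  obtain ⟨P', hP', hG'⟩ := h'
  set D : MvPolynomial (Fin n × Fin n) K :=
    Matrix.det (Matrix.of fun i j => X (i, j)) with hD
  have hev : ∀ x : Fin n × Fin n → K,
      eval x D = Matrix.det (Matrix.of fun i j => x (i, j)) := by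
    intro x
    rw [hD, RingHom.map_det]
    congr 1
    ext i j
    simp
  have hD0 : D ≠ 0 := by
    intro h0
    have := hev fun p => (1 : Matrix (Fin n) (Fin n) K) p.1 p.2
    rw [h0, map_zero] at this
    have h1 : (Matrix.of fun i j => (1 : Matrix (Fin n) (Fin n) K) i j) = 1 := rfl
    simp [h1] at this
  have hne : P * P' * D ≠ 0 := mul_ne_zero (mul_ne_zero hP hP') hD0
  obtain ⟨x, hx⟩ : ∃ x, eval x (P * P' * D) ≠ 0 := by
    by_contra! hc
    exact hne (MvPolynomial.funext fun x => by simpa using hc x)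
  simp only [map_mul, mul_ne_zero_iff] at hx
  obtain ⟨⟨h1, h2⟩, h3⟩ := hx
  rw [hev] at h3
  let A : GL (Fin n) K := Matrix.GeneralLinearGroup.mkOfDetNeZero _ h3
  rw [← hG A h1, ← hG' A h2]

/-- The generic initial ideal of `I` with respect to the degree reverse lexicographic order. -/
noncomputable def gin (I : Ideal (MvPolynomial (Fin n) K)) : Ideal (MvPolynomial (Fin n) K) :=
  Classical.epsilon (IsGin I)

/-! ### Fibre products -/

/-- The ideal `F(I, J) = I + J + Q` of `K[x_1, …, x_{n+m}]`, where
`I ⊆ K[x_1, …, x_n]`, `J ⊆ K[x_{n+1}, …, x_{n+m}]` (whose variables are indexed by `Fin m`) and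
`Q = (x_1, …, x_n) (x_{n+1}, …, x_{n+m})`. -/
noncomputable def fibreIdeal {m : ℕ} (I : Ideal (MvPolynomial (Fin n) K))
    (J : Ideal (MvPolynomial (Fin m) K)) : Ideal (MvPolynomial (Fin (n + m)) K) :=
  I.map (rename (Fin.castAdd m) : MvPolynomial (Fin n) K →ₐ[K] MvPolynomial (Fin (n + m)) K) ⊔
    J.map (rename (Fin.natAdd n) : MvPolynomial (Fin m) K →ₐ[K] MvPolynomial (Fin (n + m)) K) ⊔
    Ideal.span (Set.range fun i : Fin n => X (Fin.castAdd m i)) *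
      Ideal.span (Set.range fun j : Fin m => X (Fin.natAdd n j))

end Gin

/-! Read the columns of a generic matrix as linear forms $l_1,\dots,l_r$. Pulling relations modulo
$\varphi(L)$ back along $\varphi$ shows that $x^a\in\mathrm{gin}(L)$ iff, modulo $L$, $l^a$ lies in
the span of the $l^b$ of the same degree with $x^b<x^a$. This condition is `GenDep L a`; `gin_eq`
identifies the ideals. The problem becomes one of ranks: on an initial segment of the monomials of
one degree, the number of independent ones is the rank of the segment modulo $L$
(`card_filter_not_dep`), and rank is lower semicontinuous.

The theorem rests on two facts.

First, `GenDep` modulo $F(I,J)$ depends only on `GenDep` modulo $I$ and $J$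
(`genDep_fibreIdeal_congr`). For proper $I$ and $J$, $S/F(I,J)$ embeds in $K[x]/I\times K[y]/J$ in
positive degree. The $x$-part of each $l_j$ is again a combination of the $l_i$, so the span of an
exchangeable set of monomials is the product of its two projections (`span_mon_prod`). If the
monomials below $x^a$ form such a set, $l^a$ depends iff it depends in both factors, and in each
factor only the last $n$ (resp. $m$) forms matter (`dep_iff_of_tail`). Exchangeability can fail only
for $x^a=r\,x_k$ with $r$ in the variables after $x_k$. Then the segment up to $r\,x_1$ is
exchangeable, so its number of independent monomials is known. Those above $r\,x_k$ are the $r\,x_j$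
with $j<k$, which inherit dependence by the symmetry of generic forms (`GenDep.exchange`). Hence the
count decides $x^a$.

Second, `GenDep` is the same for $\mathrm{gin}(L)$ and $L$ (`genDep_gin_iff`). Degenerating to an
initial ideal along a torus cannot raise generic ranks; conversely, in its own coordinates
$\mathrm{gin}(L)$ already attains the generic ranks of $L$. -/

/-! ### Generic points of affine space -/

section Generic

open Filter

/-- The filter of Zariski generic points of affine space: it consists of the sets containing a
nonempty principal open set. -/
def genericPts (ι K : Type*) [Field K] : Filter (ι → K) where
  sets := {s | ∃ P : MvPolynomial ι K, P ≠ 0 ∧ ∀ x, eval x P ≠ 0 → x ∈ s}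
  univ_sets := ⟨1, one_ne_zero, fun _ _ => trivial⟩
  sets_of_superset := by
    rintro s t ⟨P, hP, h⟩ hst
    exact ⟨P, hP, fun x hx => hst (h x hx)⟩
  inter_sets := by
    rintro s t ⟨P, hP, h⟩ ⟨P', hP', h'⟩
    refine ⟨P * P', mul_ne_zero hP hP', fun x hx => ?_⟩
    rw [map_mul] at hx
    exact ⟨h x (left_ne_zero_of_mul hx), h' x (right_ne_zero_of_mul hx)⟩

variable {K : Type*} [Field K] {ι κ : Type*}

theorem eventually_eval_ne_zero {P : MvPolynomial ι K} (hP : P ≠ 0) :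
    ∀ᶠ x in genericPts ι K, eval x P ≠ 0 := ⟨P, hP, fun _ h => h⟩

theorem exists_eval_ne_zero [Infinite K] {P : MvPolynomial ι K} (hP : P ≠ 0) :
    ∃ x, eval x P ≠ 0 := by
  by_contra! hc
  exact hP (MvPolynomial.funext fun x => by simpa using hc x)

instance [Infinite K] : (genericPts ι K).NeBot := by
  rw [neBot_iff, Ne, ← empty_mem_iff_bot]
  rintro ⟨P, hP, h⟩
  obtain ⟨x, hx⟩ := exists_eval_ne_zero hP
  exact h x hx

/-- Surjective polynomial maps preserve generic points. -/
theorem tendsto_genericPts_of_surjective [Infinite K] {φ : (ι → K) → κ → K}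
    (hφ : Function.Surjective φ) (q : κ → MvPolynomial ι K)
    (hq : ∀ x k, φ x k = eval x (q k)) :
    Tendsto φ (genericPts ι K) (genericPts κ K) := by
  rintro s ⟨P, hP, h⟩
  have key : ∀ x, eval x (bind₁ q P) = eval (φ x) P := fun x => by
    have h1 : φ x = fun k => eval x (q k) := funext (hq x)
    have h2 := aeval_bind₁ x q P
    simp only [← coe_aeval_eq_eval, RingHom.coe_coe, h1] at h2 ⊢
    exact h2
  -- The pulled-back polynomial is nonzero: a point where `P` does not vanish has a preimage.
  refine ⟨bind₁ q P, fun h0 => ?_, fun x hx => h _ (by rwa [← key])⟩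
  obtain ⟨y, hy⟩ := exists_eval_ne_zero hP
  obtain ⟨x, rfl⟩ := hφ y
  exact hy (by rw [← key, h0, map_zero])

/-- Serves both to permute the columns of a generic matrix and to pass to a block of it. -/
theorem tendsto_genericPts_comp [Infinite K] {f : κ → ι} (hf : Function.Injective f) :
    Tendsto (fun x : ι → K => x ∘ f) (genericPts ι K) (genericPts κ K) :=
  tendsto_genericPts_of_surjective hf.surjective_comp_right (fun k => X (f k)) fun x k => by simp

/-- Matrices given as functions on pairs of indices. -/
abbrev toMat {n : ℕ} (B : Fin n × Fin n → K) : Matrix (Fin n) (Fin n) K :=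
  Matrix.of fun i j => B (i, j)

theorem eventually_det_ne_zero (n : ℕ) :
    ∀ᶠ B in genericPts (Fin n × Fin n) K, (toMat B).det ≠ 0 := by
  set D : MvPolynomial (Fin n × Fin n) K := Matrix.det (Matrix.of fun i j => X (i, j)) with hD
  have hev : ∀ x : Fin n × Fin n → K, eval x D = (toMat x).det := by
    intro x
    rw [hD, RingHom.map_det]
    congr 1
    ext i j
    simp
  refine ⟨D, fun h0 => ?_, fun x hx => (hev x).symm.trans_ne hx⟩
  have := hev fun p => (1 : Matrix (Fin n) (Fin n) K) p.1 p.2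
  rw [h0, map_zero] at this
  have h1 : toMat (fun p => (1 : Matrix (Fin n) (Fin n) K) p.1 p.2) = 1 := rfl
  simp [h1] at this

/-- The entries of the inverse are those of the adjugate divided by the determinant, so a power of
the determinant clears all denominators. -/
theorem exists_eval_inv {n : ℕ} (P : MvPolynomial (Fin n × Fin n) K) :
    ∃ (k : ℕ) (Q : MvPolynomial (Fin n × Fin n) K), ∀ B : Fin n × Fin n → K,
      (toMat B).det ≠ 0 →
        eval B Q = (toMat B).det ^ k * eval (fun p => (toMat B)⁻¹ p.1 p.2) P := by
  have hdet : ∃ D : MvPolynomial (Fin n × Fin n) K, ∀ B, eval B D = (toMat B).det :=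
    ⟨Matrix.det (Matrix.of fun i j => X (i, j)), fun B => by
      rw [RingHom.map_det]; congr 1; ext i j; simp⟩
  obtain ⟨D, hD⟩ := hdet
  induction P using MvPolynomial.induction_on with
  | C a => exact ⟨0, C a, fun B _ => by simp⟩
  | add p q hp hq =>
    obtain ⟨k, Q, h⟩ := hp
    obtain ⟨k', Q', h'⟩ := hq
    refine ⟨k + k', D ^ k' * Q + D ^ k * Q', fun B hB => ?_⟩
    simp only [map_add, map_mul, map_pow, hD, h B hB, h' B hB]
    ring
  | mul_X p i hp =>
    obtain ⟨k, Q, h⟩ := hp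
    refine ⟨k + 1, Q * (Matrix.adjugate (Matrix.of fun i j => X (i, j))) i.1 i.2,
      fun B hB => ?_⟩
    have hadj : eval B ((Matrix.adjugate (Matrix.of fun i j => X (i, j)) :
        Matrix (Fin n) (Fin n) (MvPolynomial (Fin n × Fin n) K)) i.1 i.2) =
        (toMat B).adjugate i.1 i.2 := by
      have := RingHom.map_adjugate (eval B)
        (Matrix.of fun i j => X (i, j) : Matrix (Fin n) (Fin n) (MvPolynomial (Fin n × Fin n) K))
      have h2 := congrFun (congrFun this i.1) i.2
      rw [RingHom.mapMatrix_apply, Matrix.map_apply] at h2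
      have h3 : (eval B).mapMatrix (Matrix.of fun i j => X (i, j)) = toMat B := by
        ext i j
        simp
      rw [h2, h3]
    have hinv : (toMat B).adjugate i.1 i.2 = (toMat B).det * (toMat B)⁻¹ i.1 i.2 := by
      rw [Matrix.inv_def, Matrix.smul_apply, smul_eq_mul, Ring.inverse_eq_inv',
        mul_inv_cancel_left₀ hB]
    rw [map_mul, h B hB, hadj, hinv, map_mul, eval_X]
    ring

/-- The inverse of a generic matrix is generic. -/
theorem tendsto_genericPts_inv [Infinite K] (n : ℕ) :
    Tendsto (fun (B : Fin n × Fin n → K) p => (toMat B)⁻¹ p.1 p.2)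
      (genericPts (Fin n × Fin n) K) (genericPts (Fin n × Fin n) K) := by
  rintro s ⟨P, hP, h⟩
  obtain ⟨k, Q, hQ⟩ := exists_eval_inv P
  -- Test `Q` at the inverse of an invertible `B` with `P(B) ≠ 0`.
  have hQ0 : Q ≠ 0 := by
    rintro rfl
    obtain ⟨B, hB, hBP⟩ := ((eventually_det_ne_zero (K := K) n).and
      (eventually_eval_ne_zero hP)).exists
    have hu : IsUnit (toMat B).det := hB.isUnit
    have := hQ (fun p => (toMat B)⁻¹ p.1 p.2)
    have he : toMat (fun p : Fin n × Fin n => (toMat B)⁻¹ p.1 p.2) = (toMat B)⁻¹ := rfl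
    rw [he, Matrix.nonsing_inv_nonsing_inv _ hu, map_zero] at this
    have h1 : (toMat B)⁻¹.det ≠ 0 := (Matrix.isUnit_nonsing_inv_det _ hu).ne_zero
    exact mul_ne_zero (pow_ne_zero k h1) hBP (this h1).symm
  rw [mem_map]
  filter_upwards [eventually_det_ne_zero (K := K) n, eventually_eval_ne_zero hQ0] with B hB hBQ
  exact h _ fun h0 => hBQ (by rw [hQ B hB, h0, mul_zero])

/-- Left multiplication by an invertible matrix preserves generic matrices. -/
theorem tendsto_genericPts_mul [Infinite K] {n : ℕ} (A : Matrix (Fin n) (Fin n) K)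
    (hA : IsUnit A.det) :
    Tendsto (fun (B : Fin n × Fin n → K) p => (A * toMat B) p.1 p.2)
      (genericPts (Fin n × Fin n) K) (genericPts (Fin n × Fin n) K) := by
  refine tendsto_genericPts_of_surjective (fun B => ?_)
    (fun p => ∑ k, C (A p.1 k) * X (k, p.2)) fun B p => ?_
  · refine ⟨fun p => (A⁻¹ * toMat B) p.1 p.2, ?_⟩
    have he : toMat (fun p : Fin n × Fin n => (A⁻¹ * toMat B) p.1 p.2) = A⁻¹ * toMat B := rfl
    funext p
    rw [he, Matrix.mul_nonsing_inv_cancel_left _ _ hA]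
    rfl
  · simp [Matrix.mul_apply]

/-! ### Polynomial maps into vector spaces -/

variable {V W : Type*} [AddCommGroup V] [Module K V] [AddCommGroup W] [Module K W]

/-- Polynomial maps from affine space to a vector space. -/
def polyMaps (ι K V : Type*) [Field K] [AddCommGroup V] [Module K V] :
    Submodule K ((ι → K) → V) :=
  Submodule.span K {f | ∃ (P : MvPolynomial ι K) (u : V), f = fun x => eval x P • u}

theorem smul_mem_polyMaps (P : MvPolynomial ι K) (u : V) :
    (fun x => eval x P • u) ∈ polyMaps ι K V := Submodule.subset_span ⟨P, u, rfl⟩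

theorem const_mem_polyMaps (u : V) : (fun _ => u) ∈ polyMaps ι K V := by
  simpa using smul_mem_polyMaps (1 : MvPolynomial ι K) u

theorem comp_mem_polyMaps (φ : V →ₗ[K] W) {f : (ι → K) → V} (hf : f ∈ polyMaps ι K V) :
    (fun x => φ (f x)) ∈ polyMaps ι K W := by
  induction hf using Submodule.span_induction with
  | mem f hf =>
    obtain ⟨P, u, rfl⟩ := hf
    simpa using smul_mem_polyMaps P (φ u)
  | zero => simpa using const_mem_polyMaps (0 : W)
  | add f g _ _ hf hg =>
    simp only [Pi.add_apply, map_add]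
    exact (polyMaps ι K W).add_mem hf hg
  | smul c f _ hf =>
    simp only [Pi.smul_apply, map_smul]
    exact (polyMaps ι K W).smul_mem c hf

theorem mul_mem_polyMaps {R : Type*} [CommRing R] [Algebra K R] {f g : (ι → K) → R}
    (hf : f ∈ polyMaps ι K R) (hg : g ∈ polyMaps ι K R) : f * g ∈ polyMaps ι K R := by
  induction hf using Submodule.span_induction with
  | mem f hf =>
    obtain ⟨P, u, rfl⟩ := hf
    induction hg using Submodule.span_induction with
    | mem g hg =>
      obtain ⟨Q, w, rfl⟩ := hg
      convert smul_mem_polyMaps (P * Q) (u * w) using 1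
      funext x
      simp [mul_smul_mul_comm]
    | zero => simp
    | add f g _ _ hf hg => rw [mul_add]; exact add_mem hf hg
    | smul c f _ hf => rw [mul_smul_comm]; exact Submodule.smul_mem _ c hf
  | zero => simp
  | add f g _ _ hf hg => rw [add_mul]; exact add_mem hf hg
  | smul c f _ hf => rw [smul_mul_assoc]; exact Submodule.smul_mem _ c hf

theorem exists_eval_eq_of_mem_polyMaps {f : (ι → K) → K} (hf : f ∈ polyMaps ι K K) :
    ∃ P : MvPolynomial ι K, ∀ x, f x = eval x P := by
  induction hf using Submodule.span_induction with
  | mem f hf =>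
    obtain ⟨P, u, rfl⟩ := hf
    exact ⟨P * C u, fun x => by simp⟩
  | zero => exact ⟨0, fun x => by simp⟩
  | add f g _ _ hf hg =>
    obtain ⟨P, hP⟩ := hf
    obtain ⟨Q, hQ⟩ := hg
    exact ⟨P + Q, fun x => by simp [hP, hQ]⟩
  | smul c f _ hf =>
    obtain ⟨P, hP⟩ := hf
    exact ⟨C c * P, fun x => by simp [hP]⟩

/-- Coordinates of a polynomial map with respect to a basis. -/
theorem exists_coords_of_mem_polyMaps {β : Type*} (b : Module.Basis β K V) {f : (ι → K) → V}
    (hf : f ∈ polyMaps ι K V) :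
    ∃ F : β →₀ MvPolynomial ι K, ∀ x, b.repr (f x) = F.mapRange (eval x) (map_zero _) := by
  induction hf using Submodule.span_induction with
  | mem f hf =>
    obtain ⟨P, u, rfl⟩ := hf
    refine ⟨(b.repr u).mapRange (fun c => P * C c) (by simp), fun x => ?_⟩
    ext k
    simp
  | zero => exact ⟨0, fun x => by simp⟩
  | add f g _ _ hf hg =>
    obtain ⟨P, hP⟩ := hf
    obtain ⟨Q, hQ⟩ := hg
    exact ⟨P + Q, fun x => by ext k; simp [hP, hQ]⟩
  | smul c f _ hf =>
    obtain ⟨P, hP⟩ := hf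
    exact ⟨P.mapRange (fun p => C c * p) (by simp), fun x => by ext k; simp [hP]⟩

/-- For polynomial families of vectors, a vector generically lies in the span of finitely many
others, or generically does not. -/
theorem eventually_mem_span_or_eventually_notMem {α : Type*} (s : Finset α)
    {f₀ : (ι → K) → V} (hf₀ : f₀ ∈ polyMaps ι K V) {f : α → (ι → K) → V}
    (hf : ∀ a, f a ∈ polyMaps ι K V) :
    (∀ᶠ x in genericPts ι K, f₀ x ∈ Submodule.span K ((fun a => f a x) '' (s : Set α))) ∨
      ∀ᶠ x in genericPts ι K, f₀ x ∉ Submodule.span K ((fun a => f a x) '' (s : Set α)) := by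
  classical
  let b := Module.Basis.ofVectorSpace K V
  let R := MvPolynomial ι K
  let F := FractionRing R
  obtain ⟨G₀, hG₀⟩ := exists_coords_of_mem_polyMaps b hf₀
  choose G hG using fun a => exists_coords_of_mem_polyMaps b (hf a)
  let toF : (Module.Basis.ofVectorSpaceIndex K V →₀ R) →
      (Module.Basis.ofVectorSpaceIndex K V →₀ F) :=
    fun g => g.mapRange (algebraMap R F) (map_zero _)
  have hinj : Function.Injective (algebraMap R F) := IsFractionRing.injective R F
  -- The alternative is decided at the generic point, that is, over the fraction field. A linear
  -- combination there specialises wherever its common denominator does not vanish.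
  by_cases hmem : toF G₀ ∈ Submodule.span F ((fun a => toF (G a)) '' (s : Set α))
  · left
    rw [Submodule.mem_span_image_finset_iff_exists_fun'] at hmem
    obtain ⟨c, hc⟩ := hmem
    obtain ⟨d, hd⟩ := IsLocalization.exist_integer_multiples (nonZeroDivisors R) s c
    choose! c' hc' using hd
    have hd0 : (d : R) ≠ 0 := nonZeroDivisors.coe_ne_zero d
    filter_upwards [eventually_eval_ne_zero hd0] with x hx
    rw [Submodule.mem_span_image_finset_iff_exists_fun']
    have hk : ∀ k, (d : R) * G₀ k = ∑ a ∈ s, c' a * G a k := by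
      intro k
      apply hinj
      have := DFunLike.congr_fun hc k
      simp only [Finsupp.coe_finsetSum, Finset.sum_apply, Finsupp.smul_apply, toF,
        Finsupp.mapRange_apply, smul_eq_mul] at this
      rw [map_mul, ← this, Finset.mul_sum, map_sum]
      refine Finset.sum_congr rfl fun a ha => ?_
      rw [map_mul, hc' a ha, Algebra.smul_def, mul_assoc]
    refine ⟨fun a => (eval x (d : R))⁻¹ * eval x (c' a), ?_⟩
    apply b.repr.injective
    ext k
    rw [map_sum, hG₀]
    simp only [map_smul, hG, Finsupp.coe_finsetSum, Finset.sum_apply, Finsupp.smul_apply,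
      Finsupp.mapRange_apply, smul_eq_mul]
    have := congrArg (eval x) (hk k)
    rw [map_mul, map_sum] at this
    simp only [mul_assoc, ← Finset.mul_sum]
    rw [inv_mul_eq_iff_eq_mul₀ hx, this]
    simp
  · right
    -- A separating functional, with denominators cleared on the finitely many coordinates in use,
    -- gives polynomial coefficients that annihilate the family. It still separates wherever its
    -- value on `G₀` is nonzero.
    obtain ⟨φ, hφ₀, hφ⟩ := Submodule.exists_dual_map_eq_bot_of_notMem hmem inferInstance
    let T : Finset (Module.Basis.ofVectorSpaceIndex K V) :=
      G₀.support ∪ s.biUnion fun a => (G a).support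
    obtain ⟨d, hd⟩ := IsLocalization.exist_integer_multiples (nonZeroDivisors R) T
      (fun k => φ (Finsupp.single k 1))
    choose! c hc using hd
    have hd0 : (d : R) ≠ 0 := nonZeroDivisors.coe_ne_zero d
    have key : ∀ g : Module.Basis.ofVectorSpaceIndex K V →₀ R, g.support ⊆ T →
        algebraMap R F (∑ k ∈ T, g k * c k) = algebraMap R F d * φ (toF g) := by
      intro g hg
      have h1 : toF g = ∑ k ∈ T, (algebraMap R F (g k)) • Finsupp.single k (1 : F) := by
        ext k
        simp only [toF, Finsupp.mapRange_apply, Finsupp.coe_finsetSum, Finset.sum_apply,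
          Finsupp.smul_apply, Finsupp.single_apply, smul_eq_mul, mul_ite, mul_one, mul_zero,
          Finset.sum_ite_eq']
        split_ifs with h
        · rfl
        · rw [Finsupp.notMem_support_iff.1 fun h' => h (hg h'), map_zero]
      rw [h1, map_sum, map_sum, Finset.mul_sum]
      refine Finset.sum_congr rfl fun k hk => ?_
      rw [map_mul, hc k hk, map_smul, Algebra.smul_def, smul_eq_mul]
      ring
    have hP : (∑ k ∈ T, G₀ k * c k) ≠ 0 := by
      intro h0
      have := key G₀ Finset.subset_union_left
      rw [h0, map_zero] at this
      exact mul_ne_zero (by simp) hφ₀ this.symm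
    have hZ : ∀ a ∈ s, (∑ k ∈ T, G a k * c k) = 0 := by
      intro a ha
      apply hinj
      rw [key (G a) ((Finset.subset_biUnion_of_mem (fun a => (G a).support) ha).trans
        Finset.subset_union_right), map_zero]
      have : φ (toF (G a)) ∈ Submodule.map φ
          (Submodule.span F ((fun a => toF (G a)) '' (s : Set α))) :=
        Submodule.mem_map_of_mem (Submodule.subset_span ⟨a, ha, rfl⟩)
      rw [hφ, Submodule.mem_bot] at this
      rw [this, mul_zero]
    filter_upwards [eventually_eval_ne_zero hP] with x hx hmem'
    rw [Submodule.mem_span_image_finset_iff_exists_fun'] at hmem'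
    obtain ⟨e, he⟩ := hmem'
    apply hx
    have hk : ∀ k, eval x (G₀ k) = ∑ a ∈ s, e a * eval x (G a k) := by
      intro k
      have := DFunLike.congr_fun (congrArg b.repr he) k
      rw [map_sum, hG₀] at this
      simpa [hG] using this.symm
    simp only [map_sum, map_mul, hk, Finset.sum_mul]
    rw [Finset.sum_comm]
    refine Finset.sum_eq_zero fun a ha => ?_
    have := congrArg (eval x) (hZ a ha)
    simp only [map_sum, map_mul, map_zero] at this
    simp only [mul_assoc, ← Finset.mul_sum, this, mul_zero]

/-- Linear independence of a polynomial family is an open condition. -/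
theorem eventually_linearIndependent {α : Type*} [Finite α] {f : α → (ι → K) → V}
    (hf : ∀ a, f a ∈ polyMaps ι K V) {x₀ : ι → K} (h₀ : LinearIndependent K fun a => f a x₀) :
    ∀ᶠ x in genericPts ι K, LinearIndependent K fun a => f a x := by
  classical
  have := Fintype.ofFinite α
  -- With coordinates dual to the vectors at `x₀`, the determinant of the family is a polynomial
  -- with value 1 at `x₀`.
  obtain ⟨ψ, hψ⟩ : ∃ ψ : V →ₗ[K] (α → K), ∀ a, ψ (f a x₀) = Pi.single a 1 := by
    obtain ⟨g, hg⟩ := LinearMap.exists_extend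
      ((Finsupp.linearEquivFunOnFinite K K α).toLinearMap ∘ₗ h₀.repr)
    refine ⟨g, fun a => ?_⟩
    have hm : f a x₀ ∈ Submodule.span K (Set.range fun a => f a x₀) :=
      Submodule.subset_span ⟨a, rfl⟩
    have h1 := LinearMap.congr_fun hg ⟨_, hm⟩
    have h2 : h₀.repr ⟨f a x₀, hm⟩ = Finsupp.single a 1 := h₀.repr_eq_single a _ rfl
    simp only [LinearMap.comp_apply, Submodule.subtype_apply, h2] at h1
    rw [h1]
    simp
  choose P hP using fun a b => exists_eval_eq_of_mem_polyMaps
    (comp_mem_polyMaps ((LinearMap.proj b : (α → K) →ₗ[K] K) ∘ₗ ψ) (hf a))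
  have hdet : ∀ x, eval x (Matrix.det (Matrix.of P)) = (Matrix.of fun a b => ψ (f a x) b).det := by
    intro x
    rw [RingHom.map_det]
    congr 1
    ext a b
    simp [← hP]
  have hne : Matrix.det (Matrix.of P) ≠ 0 := by
    intro h
    have := hdet x₀
    rw [h, map_zero] at this
    have h1 : (Matrix.of fun a b => ψ (f a x₀) b) = (1 : Matrix α α K) := by
      ext a b
      simp [hψ, Matrix.one_apply, Pi.single_apply, eq_comm]
    simp [h1] at this
  filter_upwards [eventually_eval_ne_zero hne] with x hx
  rw [hdet] at hx
  have := Matrix.linearIndependent_rows_of_det_ne_zero hx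
  exact LinearIndependent.of_comp ψ this

/-- The rank of a polynomial family of vectors is lower semicontinuous. -/
theorem eventually_finrank_span_le {α : Type*} (s : Finset α) {f : α → (ι → K) → V}
    (hf : ∀ a, f a ∈ polyMaps ι K V) (x₀ : ι → K) :
    ∀ᶠ x in genericPts ι K,
      Module.finrank K (Submodule.span K ((fun a => f a x₀) '' (s : Set α))) ≤
        Module.finrank K (Submodule.span K ((fun a => f a x) '' (s : Set α))) := by
  classical
  -- A basis chosen from the vectors at `x₀` stays independent at generic points.
  obtain ⟨t, hts, -, hspan, hli⟩ := exists_linearIndepOn_extension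
    (linearIndepOn_empty K fun a => f a x₀) (Set.empty_subset (s : Set α))
  have hfin : Finite t := s.finite_toSet.subset hts
  filter_upwards [eventually_linearIndependent (α := t) (fun a => hf a) hli] with x hx
  have hfd : FiniteDimensional K (Submodule.span K ((fun a => f a x) '' (s : Set α))) :=
    FiniteDimensional.span_of_finite K (s.finite_toSet.image _)
  have := Fintype.ofFinite t
  calc _ ≤ Module.finrank K (Submodule.span K ((fun a => f a x₀) '' t)) := by
        have := FiniteDimensional.span_of_finite K
          ((s.finite_toSet.subset hts).image fun a => f a x₀)
        exact Submodule.finrank_mono (Submodule.span_le.2 hspan)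
    _ = Fintype.card t := by
        rw [Set.image_eq_range]
        exact finrank_span_eq_card hli
    _ = Module.finrank K (Submodule.span K ((fun a => f a x) '' t)) := by
        rw [Set.image_eq_range]
        exact (finrank_span_eq_card hx).symm
    _ ≤ _ := Submodule.finrank_mono (Submodule.span_mono (Set.image_mono hts))

end Generic

/-! ### The degree reverse lexicographic order in a fixed degree -/

section RevLt

variable {n : ℕ}

/-- `x^b < x^a` in the reverse lexicographic order, for exponents of the same degree. -/
def RevLt (b a : Fin n →₀ ℕ) : Prop :=
  b.degree = a.degree ∧ ∃ i, (∀ j, i < j → b j = a j) ∧ a i < b i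

theorem revLt_iff {b a : Fin n →₀ ℕ} :
    RevLt b a ↔ b.degree = a.degree ∧ DegRevLex.of b < DegRevLex.of a := by
  rw [DegRevLex.lt_iff]
  refine and_congr_right fun h => ?_
  simp [h]

theorem RevLt.trans {c b a : Fin n →₀ ℕ} (h : RevLt c b) (h' : RevLt b a) : RevLt c a := by
  rw [revLt_iff] at *
  exact ⟨h.1.trans h'.1, h.2.trans h'.2⟩

theorem not_revLt_self (a : Fin n →₀ ℕ) : ¬ RevLt a a := fun h => (revLt_iff.1 h).2.false

theorem revLt_trichotomy {b a : Fin n →₀ ℕ} (h : b.degree = a.degree) :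
    RevLt b a ∨ b = a ∨ RevLt a b := by
  rcases lt_trichotomy (DegRevLex.of b) (DegRevLex.of a) with h1 | h1 | h1
  · exact Or.inl (revLt_iff.2 ⟨h, h1⟩)
  · exact Or.inr (Or.inl (DegRevLex.of.injective h1))
  · exact Or.inr (Or.inr (revLt_iff.2 ⟨h.symm, h1⟩))

theorem RevLt.add_right {b a : Fin n →₀ ℕ} (h : RevLt b a) (c : Fin n →₀ ℕ) :
    RevLt (b + c) (a + c) := by
  obtain ⟨h1, i, h2, h3⟩ := h
  exact ⟨by simp [h1], i, fun j hj => by simp [h2 j hj], by simpa using h3⟩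

theorem finite_revLt (a : Fin n →₀ ℕ) : {b | RevLt b a}.Finite :=
  (Finsupp.finite_of_degree_le (σ := Fin n) a.degree).subset fun _ hb => hb.1.le

theorem wellFounded_revLt : WellFounded (RevLt (n := n)) :=
  Subrelation.wf (fun h => (revLt_iff.1 h).2)
    (InvImage.wf (DegRevLex.of (σ := Fin n)) wellFounded_lt)

/-- Equality beyond `p` is not needed: at the last index where the exponents differ, `b` has the
larger one. -/
theorem revLt_of_le_of_lt {b a : Fin n →₀ ℕ} (h : b.degree = a.degree) {p : Fin n}
    (hp : a p < b p) (hle : ∀ q, p < q → a q ≤ b q) : RevLt b a := by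
  let s : Finset (Fin n) := Finset.univ.filter fun q => a q ≠ b q
  have hps : p ∈ s := by simp [s, hp.ne]
  refine ⟨h, s.max' ⟨p, hps⟩, fun j hj => ?_, ?_⟩
  · by_contra hne
    exact (s.le_max' j (by simpa [s] using Ne.symm hne)).not_gt hj
  · rcases (s.le_max' p hps).eq_or_lt with h1 | h1
    · rwa [← h1]
    · have := s.max'_mem ⟨p, hps⟩
      simp only [s, Finset.mem_filter, Finset.mem_univ, true_and] at this
      exact lt_of_le_of_ne (hle _ h1) this

theorem revLt_add_single {i j : Fin n} (h : j < i) (r : Fin n →₀ ℕ) :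
    RevLt (r + Finsupp.single i 1) (r + Finsupp.single j 1) := by
  refine revLt_of_le_of_lt (p := i) (by simp) ?_ fun q hq => ?_
  · simp [h.ne]
  · simp [Finsupp.single_apply, (h.trans hq).ne]

theorem eq_of_le_of_degree_eq {a b : Fin n →₀ ℕ} (h : a ≤ b) (hd : a.degree = b.degree) :
    a = b := by
  have h1 := add_tsub_cancel_of_le h
  have h2 := congrArg Finsupp.degree h1
  rw [map_add] at h2
  have h3 : (b - a).degree = 0 := by omega
  rw [Finsupp.degree_eq_zero_iff] at h3
  rw [← h1, h3, add_zero]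

theorem exists_eq_single_of_degree_eq_one {a : Fin n →₀ ℕ} (h : a.degree = 1) :
    ∃ j, a = Finsupp.single j 1 := by
  have hne : a ≠ 0 := fun h0 => by simp [h0] at h
  obtain ⟨j, hj⟩ := Finsupp.ne_iff.1 hne
  exact ⟨j, (eq_of_le_of_degree_eq (Finsupp.single_le_iff.2 (Nat.one_le_iff_ne_zero.2 hj))
    (by simp [h])).symm⟩

/-- A monomial below `x^a` either has a divisor of degree one less all of whose multiples of the
same degree stay below `x^a`, or arises from `x^a` by replacing the first variable, which occurs
only once. -/
theorem RevLt.exists_lowering {b a : Fin n →₀ ℕ} (h : RevLt b a) :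
    (∃ s j, b = s + Finsupp.single j 1 ∧ ∀ i, RevLt (s + Finsupp.single i 1) a) ∨
      ∃ r j p, j < p ∧ b = r + Finsupp.single p 1 ∧ a = r + Finsupp.single j 1 ∧
        ∀ q, q < p → r q = 0 := by
  obtain ⟨hd, p, hp, hlt⟩ := h
  have hsub : ∀ j, 0 < b j → b = (b - Finsupp.single j 1) + Finsupp.single j 1 := fun j hj =>
    (tsub_add_cancel_of_le (Finsupp.single_le_iff.2 hj)).symm
  have hdeg : ∀ j, 0 < b j → ∀ i,
      ((b - Finsupp.single j 1) + Finsupp.single i 1).degree = a.degree := fun j hj i => by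
    have := congrArg Finsupp.degree (hsub j hj)
    simp only [map_add, Finsupp.degree_single] at this ⊢
    omega
  -- Dividing by a variable before `x_p` leaves the surplus of `b` at `p` intact, whatever variable
  -- is multiplied back in.
  by_cases h1 : ∃ j, j < p ∧ 0 < b j
  · obtain ⟨j, hjp, hj⟩ := h1
    refine Or.inl ⟨_, j, hsub j hj, fun i => revLt_of_le_of_lt (hdeg j hj i) (p := p) ?_ ?_⟩
    · simp only [Finsupp.add_apply, Finsupp.tsub_apply, Finsupp.single_apply, hjp.ne, if_false]
      omega
    · intro q hq
      simp only [Finsupp.add_apply, Finsupp.tsub_apply, Finsupp.single_apply, (hjp.trans hq).ne,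
        if_false, hp q hq]
      omega
  -- A surplus of at least two at `p` survives division by `x_p`.
  by_cases h2 : a p + 1 < b p
  · have hj : 0 < b p := by omega
    refine Or.inl ⟨_, p, hsub p hj, fun i => revLt_of_le_of_lt (hdeg p hj i) (p := p) ?_ ?_⟩
    · simp only [Finsupp.add_apply, Finsupp.tsub_apply, Finsupp.single_apply, if_true]
      omega
    · intro q hq
      simp only [Finsupp.add_apply, Finsupp.tsub_apply, Finsupp.single_apply, hq.ne,
        if_false, hp q hq]
      omega
  -- What remains is `b p = a p + 1` and no variable of `b` before `p`. Then `b / x_p` divides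
  -- `x^a`, with a single variable as quotient.
  right
  push Not at h1
  have hj : 0 < b p := by omega
  set r := b - Finsupp.single p 1 with hr
  have hrp : ∀ q, r q ≤ a q := by
    intro q
    rcases lt_trichotomy q p with hq | rfl | hq
    · have := h1 q hq
      simp [hr]; omega
    · simp [hr]; omega
    · simp [hr, hp q hq]
  have hra : r + (a - r) = a := add_tsub_cancel_of_le hrp
  have hdr : (a - r).degree = 1 := by
    have e1 := congrArg Finsupp.degree hra
    have e2 : b.degree = (r + Finsupp.single p 1).degree := congrArg Finsupp.degree (hsub p hj)
    simp only [map_add, Finsupp.degree_single] at e1 e2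
    omega
  obtain ⟨j, hj'⟩ := exists_eq_single_of_degree_eq_one hdr
  refine ⟨r, j, p, ?_, hsub p hj, by rw [← hj', hra], fun q hq => ?_⟩
  · by_contra hpj
    have e := DFunLike.congr_fun hj' j
    rw [Finsupp.tsub_apply, Finsupp.single_eq_same, hr, Finsupp.tsub_apply] at e
    rcases (not_lt.1 hpj).eq_or_lt with rfl | h6
    · simp at e; omega
    · simp [h6.ne, hp j h6] at e
  · have := h1 q hq
    simp [hr]; omega

/-- The monomials strictly below `x^a` in the same degree. -/
noncomputable def ltFinset (a : Fin n →₀ ℕ) : Finset (Fin n →₀ ℕ) := (finite_revLt a).toFinset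

/-- The monomials below or equal to `x^a` in the same degree. -/
noncomputable def leFinset (a : Fin n →₀ ℕ) : Finset (Fin n →₀ ℕ) := by
  classical exact insert a (ltFinset a)

/-- The monomials of degree `d`. -/
noncomputable def degFinset (n d : ℕ) : Finset (Fin n →₀ ℕ) :=
  ((Finsupp.finite_of_degree_le (σ := Fin n) d).subset
    fun _ (h : _ = d) => h.le : {b : Fin n →₀ ℕ | b.degree = d}.Finite).toFinset

@[simp] theorem mem_ltFinset {a b : Fin n →₀ ℕ} : b ∈ ltFinset a ↔ RevLt b a := by
  simp [ltFinset]

@[simp] theorem mem_leFinset {a b : Fin n →₀ ℕ} : b ∈ leFinset a ↔ b = a ∨ RevLt b a := by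
  classical simp [leFinset]

@[simp] theorem mem_degFinset {d : ℕ} {b : Fin n →₀ ℕ} : b ∈ degFinset n d ↔ b.degree = d := by
  simp [degFinset]

/-- Initial segments of the monomials of some fixed degree. -/
structure IsInitialSeg (s : Finset (Fin n →₀ ℕ)) : Prop where
  degree_eq : ∀ a ∈ s, ∀ b ∈ s, a.degree = b.degree
  mem_of_revLt : ∀ a ∈ s, ∀ b, RevLt b a → b ∈ s

theorem isInitialSeg_ltFinset (a : Fin n →₀ ℕ) : IsInitialSeg (ltFinset a) where
  degree_eq b hb c hc := by
    rw [mem_ltFinset] at hb hc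
    exact hb.1.trans hc.1.symm
  mem_of_revLt b hb c hc := by
    rw [mem_ltFinset] at *
    exact hc.trans hb

theorem isInitialSeg_leFinset (a : Fin n →₀ ℕ) : IsInitialSeg (leFinset a) where
  degree_eq b hb c hc := by
    rw [mem_leFinset] at hb hc
    have : ∀ x, (x = a ∨ RevLt x a) → x.degree = a.degree := by
      rintro x (rfl | h)
      exacts [rfl, h.1]
    exact (this b hb).trans (this c hc).symm
  mem_of_revLt b hb c hc := by
    rw [mem_leFinset] at *
    rcases hb with rfl | hb
    exacts [Or.inr hc, Or.inr (hc.trans hb)]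

theorem isInitialSeg_degFinset (d : ℕ) : IsInitialSeg (degFinset n d) where
  degree_eq b hb c hc := by
    rw [mem_degFinset] at *
    rw [hb, hc]
  mem_of_revLt b hb c hc := by
    rw [mem_degFinset] at *
    rw [hc.1, hb]

-- The segments strictly below `a` and up to `a` differ only in `a`, so comparing the two counts
-- isolates the truth value at `a`.
open Classical in
theorem iff_of_card_filter_not_eq {D D' : (Fin n →₀ ℕ) → Prop}
    (h : ∀ s : Finset (Fin n →₀ ℕ), IsInitialSeg s →
      (s.filter fun a => ¬ D a).card = (s.filter fun a => ¬ D' a).card)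
    (a : Fin n →₀ ℕ) : D a ↔ D' a := by
  have h1 := h _ (isInitialSeg_ltFinset a)
  have h2 := h _ (isInitialSeg_leFinset a)
  have ha : a ∉ ltFinset a := by simpa using not_revLt_self a
  have hle : leFinset a = insert a (ltFinset a) := by ext; simp
  rw [hle, Finset.filter_insert, Finset.filter_insert] at h2
  by_cases hD : D a <;> by_cases hD' : D' a <;> simp [hD, hD', ha, h1] at h2 ⊢

end RevLt

/-! ### Counting jumps in a flag of spans -/

section Counting

variable {K V α β : Type*} [Field K] [AddCommGroup V] [Module K V] [LinearOrder β]

-- Adding the vectors in increasing order, the dimension grows by one exactly at those outside the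
-- span of their predecessors.
open Classical in
theorem card_filter_notMem_span (s : Finset α) {f : α → β} (hf : Function.Injective f)
    (v : α → V) :
    (s.filter fun a => v a ∉ Submodule.span K (v '' {b | b ∈ s ∧ f b < f a})).card =
      Module.finrank K (Submodule.span K (v '' (s : Set α))) := by
  induction s using Finset.induction_on_max_value f with
  | empty => rw [Finset.coe_empty, Set.image_empty, Submodule.span_empty, finrank_bot]; simp
  | insert a s ha hmax ih =>
    have hlt : ∀ x ∈ s, f x < f a := fun x hx =>
      lt_of_le_of_ne (hmax x hx) fun h => ha (hf h ▸ hx)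
    have h1 : {b | b ∈ insert a s ∧ f b < f a} = (s : Set α) := by
      ext b
      simp only [Finset.mem_insert, Set.mem_ofPred_eq, Finset.mem_coe]
      constructor
      · rintro ⟨rfl | h, h'⟩
        · exact absurd h' (lt_irrefl _)
        · exact h
      · exact fun h => ⟨Or.inr h, hlt b h⟩
    have h2 : ∀ x ∈ s, {b | b ∈ insert a s ∧ f b < f x} = {b | b ∈ s ∧ f b < f x} := by
      intro x hx
      ext b
      simp only [Finset.mem_insert, Set.mem_ofPred_eq]
      constructor
      · rintro ⟨rfl | h, h'⟩
        · exact absurd (h'.trans (hlt x hx)) (lt_irrefl _)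
        · exact ⟨h, h'⟩
      · exact fun h => ⟨Or.inr h.1, h.2⟩
    have h3 : (s.filter fun x =>
        v x ∉ Submodule.span K (v '' {b | b ∈ insert a s ∧ f b < f x})) =
        s.filter fun x => v x ∉ Submodule.span K (v '' {b | b ∈ s ∧ f b < f x}) :=
      Finset.filter_congr fun x hx => by rw [h2 x hx]
    rw [Finset.filter_insert, h1, h3, Finset.coe_insert, Set.image_insert_eq]
    have : FiniteDimensional K (Submodule.span K (v '' (s : Set α))) :=
      FiniteDimensional.span_of_finite K (s.finite_toSet.image _)
    by_cases hmem : v a ∈ Submodule.span K (v '' (s : Set α))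
    · rw [if_neg (not_not.2 hmem), ih, Submodule.span_insert_eq_span hmem]
    · rw [if_pos hmem, Finset.card_insert_of_notMem (by simp [ha]), ih, Submodule.span_insert,
        sup_comm]
      have hne : v a ≠ 0 := fun h => hmem (h ▸ Submodule.zero_mem _)
      have hdis : Disjoint (Submodule.span K (v '' (s : Set α))) (Submodule.span K {v a}) :=
        (Submodule.disjoint_span_singleton' hne).2 hmem
      have := Submodule.finrank_sup_add_finrank_inf_eq (Submodule.span K (v '' (s : Set α)))
        (Submodule.span K {v a})
      rw [hdis.eq_bot, finrank_bot, finrank_span_singleton hne] at this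
      omega

end Counting

/-! ### Monomials in a family of ring elements and their linear dependence -/

section Dep

variable {K : Type*} [Field K] {R R' : Type*} [CommRing R] [Algebra K R] [CommRing R']
  [Algebra K R'] {n : ℕ}

/-- The value of the monomial `x^a` at a family `l` of ring elements. -/
def mon {R : Type*} [CommRing R] (l : Fin n → R) (a : Fin n →₀ ℕ) : R := ∏ i, l i ^ a i

theorem mon_add (l : Fin n → R) (a b : Fin n →₀ ℕ) : mon l (a + b) = mon l a * mon l b := by
  simp [mon, pow_add, Finset.prod_mul_distrib]

theorem mon_single (l : Fin n → R) (i : Fin n) : mon l (Finsupp.single i 1) = l i := by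
  rw [mon, Finset.prod_eq_single i]
  · simp
  · intro j _ hj
    simp [hj.symm]
  · simp

theorem mon_zero (l : Fin n → R) : mon l 0 = 1 := by simp [mon]

theorem map_mon (φ : R →ₐ[K] R') (l : Fin n → R) (a : Fin n →₀ ℕ) :
    φ (mon l a) = mon (fun i => φ (l i)) a := by
  simp [mon]

theorem mon_X (a : Fin n →₀ ℕ) :
    mon (X : Fin n → MvPolynomial (Fin n) K) a = monomial a 1 := by
  rw [monomial_eq, Finsupp.prod_fintype _ _ (by simp)]
  simp [mon]

variable (K) in
/-- The monomial `x^a` evaluated at `l` depends linearly on the smaller ones of the same degree. -/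
def Dep (l : Fin n → R) (a : Fin n →₀ ℕ) : Prop :=
  mon l a ∈ Submodule.span K (mon l '' {b | RevLt b a})

theorem Dep.map {l : Fin n → R} {a : Fin n →₀ ℕ} (h : Dep K l a) (φ : R →ₐ[K] R') :
    Dep K (fun i => φ (l i)) a := by
  have := Submodule.mem_map_of_mem (f := φ.toLinearMap) h
  rw [Submodule.map_span, ← Set.image_comp] at this
  simpa [Dep, Function.comp_def, map_mon] using this

theorem Dep.add {l : Fin n → R} {a : Fin n →₀ ℕ} (h : Dep K l a) (c : Fin n →₀ ℕ) :
    Dep K l (a + c) := by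
  have := Submodule.mem_map_of_mem (f := LinearMap.mulRight K (mon l c)) h
  rw [Submodule.map_span, ← Set.image_comp, LinearMap.mulRight_apply, ← mon_add] at this
  refine Submodule.span_mono ?_ this
  rintro _ ⟨b, hb, rfl⟩
  exact ⟨b + c, hb.add_right c, by simp [mon_add]⟩

theorem Dep.mono {l : Fin n → R} {a b : Fin n →₀ ℕ} (h : Dep K l a) (hab : a ≤ b) :
    Dep K l b := by
  rw [← add_tsub_cancel_of_le hab]
  exact h.add _

-- In an initial segment the predecessors of a member are all the smaller monomials of its degree,
-- so independent monomials are exactly the jumps of the flag of spans.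
open Classical in
theorem card_filter_not_dep (l : Fin n → R) {s : Finset (Fin n →₀ ℕ)} (hs : IsInitialSeg s) :
    (s.filter fun a => ¬ Dep K l a).card =
      Module.finrank K (Submodule.span K (mon l '' (s : Set (Fin n →₀ ℕ)))) := by
  rw [← card_filter_notMem_span s (DegRevLex.of (σ := Fin n)).injective (mon l)]
  congr 1
  refine Finset.filter_congr fun a ha => ?_
  have : {b | RevLt b a} = {b | b ∈ s ∧ DegRevLex.of b < DegRevLex.of a} := by
    ext b
    rw [Set.mem_ofPred_eq, Set.mem_ofPred_eq, revLt_iff]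
    constructor
    · exact fun h => ⟨hs.mem_of_revLt a ha b (revLt_iff.2 h), h.2⟩
    · exact fun h => ⟨hs.degree_eq b h.1 a ha, h.2⟩
  rw [Dep, this]

/-- Membership in a span only depends on the kernel of a linear map. -/
theorem mem_span_image_congr {V W W' α : Type*} [AddCommGroup V] [Module K V] [AddCommGroup W]
    [Module K W] [AddCommGroup W'] [Module K W'] (f : V →ₗ[K] W) (g : V →ₗ[K] W')
    (U : Submodule K V) (hU : ∀ u ∈ U, f u = 0 ↔ g u = 0) (v : α → V) {s : Set α}
    (hv : ∀ a ∈ s, v a ∈ U) {u : V} (hu : u ∈ U) :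
    f u ∈ Submodule.span K ((fun a => f (v a)) '' s) ↔
      g u ∈ Submodule.span K ((fun a => g (v a)) '' s) := by
  have hf : (fun a => f (v a)) '' s = f '' (v '' s) := by rw [← Set.image_comp]; rfl
  have hg : (fun a => g (v a)) '' s = g '' (v '' s) := by rw [← Set.image_comp]; rfl
  rw [hf, hg, ← Submodule.map_span, ← Submodule.map_span, Submodule.mem_map, Submodule.mem_map]
  refine exists_congr fun w => and_congr_right fun hw => ?_
  rw [← sub_eq_zero, ← map_sub, ← sub_eq_zero (a := g w), ← map_sub]
  refine hU _ (U.sub_mem ?_ hu)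
  exact Submodule.span_le.2 (by rintro _ ⟨a, ha, rfl⟩; exact hv a ha) hw

theorem mon_comp {k : ℕ} (l : Fin n → R) {σ : Fin k → Fin n} (hσ : Function.Injective σ)
    (a : Fin k →₀ ℕ) : mon (l ∘ σ) a = mon l (a.mapDomain σ) := by
  have h : ∀ {k : ℕ} (l : Fin k → R) (a : Fin k →₀ ℕ), mon l a = a.prod fun i e => l i ^ e :=
    fun l a => (Finsupp.prod_fintype _ _ fun i => pow_zero _).symm
  rw [h, h, Finsupp.prod_mapDomain_index_inj hσ]
  rfl

end Dep

/-! ### Generic dependence -/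

section GenDep

open Filter

variable {K : Type*} [Field K] {n : ℕ}

/-- The linear forms given by the columns of a matrix. -/
noncomputable def lin (B : Fin n × Fin n → K) (j : Fin n) : MvPolynomial (Fin n) K :=
  ∑ i, C (B (i, j)) * X i

/-- The residue classes of the linear forms given by the columns of a matrix. -/
noncomputable def linMk (L : Ideal (MvPolynomial (Fin n) K)) (B : Fin n × Fin n → K)
    (j : Fin n) : MvPolynomial (Fin n) K ⧸ L :=
  Ideal.Quotient.mkₐ K L (lin B j)

theorem mon_mem_polyMaps {ι R : Type*} [CommRing R] [Algebra K R] {l : Fin n → (ι → K) → R}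
    (hl : ∀ j, l j ∈ polyMaps ι K R) (a : Fin n →₀ ℕ) :
    (fun x => mon (fun j => l j x) a) ∈ polyMaps ι K R := by
  have h1 : (1 : (ι → K) → R) ∈ polyMaps ι K R := const_mem_polyMaps (1 : R)
  have hpow : ∀ j k, l j ^ k ∈ polyMaps ι K R := by
    intro j k
    induction k with
    | zero => simpa using h1
    | succ k ih => rw [pow_succ]; exact mul_mem_polyMaps ih (hl j)
  have : (fun x => mon (fun j => l j x) a) = ∏ j, l j ^ a j := by
    funext x
    simp [mon]
  rw [this]
  exact Finset.prod_induction _ (· ∈ polyMaps ι K R) (fun _ _ => mul_mem_polyMaps) h1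
    fun j _ => hpow j _

theorem lin_mem_polyMaps (j : Fin n) :
    (fun B => lin (K := K) B j) ∈ polyMaps (Fin n × Fin n) K (MvPolynomial (Fin n) K) := by
  have : (fun B => lin (K := K) B j) =
      ∑ i, fun B => eval B (X (i, j) : MvPolynomial (Fin n × Fin n) K) •
        (X i : MvPolynomial (Fin n) K) := by
    funext B
    simp [lin, smul_eq_C_mul]
  rw [this]
  exact Submodule.sum_mem _ fun i _ => smul_mem_polyMaps _ _

theorem linMk_mem_polyMaps (L : Ideal (MvPolynomial (Fin n) K)) (j : Fin n) :
    (fun B => linMk L B j) ∈ polyMaps (Fin n × Fin n) K (MvPolynomial (Fin n) K ⧸ L) :=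
  comp_mem_polyMaps (Ideal.Quotient.mkₐ K L).toLinearMap (lin_mem_polyMaps j)

/-- For generic linear forms `l`, the monomial `l^a` depends modulo `L` on the smaller ones. -/
def GenDep (L : Ideal (MvPolynomial (Fin n) K)) (a : Fin n →₀ ℕ) : Prop :=
  ∀ᶠ B in genericPts (Fin n × Fin n) K, Dep K (linMk L B) a

/-- Generic behaviour is two-valued: by `eventually_mem_span_or_eventually_notMem`, dependence that
is not generic fails generically. -/
theorem eventually_not_dep_of_not_genDep {L : Ideal (MvPolynomial (Fin n) K)} {a : Fin n →₀ ℕ}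
    (h : ¬ GenDep L a) : ∀ᶠ B in genericPts (Fin n × Fin n) K, ¬ Dep K (linMk L B) a := by
  have := eventually_mem_span_or_eventually_notMem (ltFinset a)
    (mon_mem_polyMaps (linMk_mem_polyMaps L) a)
    (f := fun b B => mon (linMk L B) b) (mon_mem_polyMaps (linMk_mem_polyMaps L))
  have hc : ((ltFinset a : Finset _) : Set (Fin n →₀ ℕ)) = {b | RevLt b a} := by ext; simp
  rw [hc] at this
  exact this.resolve_left h

theorem eventually_dep_iff_genDep (L : Ideal (MvPolynomial (Fin n) K)) (a : Fin n →₀ ℕ) :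
    ∀ᶠ B in genericPts (Fin n × Fin n) K, (Dep K (linMk L B) a ↔ GenDep L a) := by
  by_cases h : GenDep L a
  · filter_upwards [h] with B hB
    exact iff_of_true hB h
  · filter_upwards [eventually_not_dep_of_not_genDep h] with B hB
    exact iff_of_false hB h

theorem GenDep.mono {L : Ideal (MvPolynomial (Fin n) K)} {a b : Fin n →₀ ℕ} (h : GenDep L a)
    (hab : a ≤ b) : GenDep L b := by
  filter_upwards [h] with B hB
  exact hB.mono hab

open Classical in
theorem eventually_finrank_span_eq [Infinite K] (L : Ideal (MvPolynomial (Fin n) K))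
    {s : Finset (Fin n →₀ ℕ)} (hs : IsInitialSeg s) :
    ∀ᶠ B in genericPts (Fin n × Fin n) K,
      Module.finrank K (Submodule.span K (mon (linMk L B) '' (s : Set (Fin n →₀ ℕ)))) =
        (s.filter fun a => ¬ GenDep L a).card := by
  filter_upwards [(Filter.eventually_all_finset s).2 fun a _ => eventually_dep_iff_genDep L a]
    with B hB
  rw [← card_filter_not_dep _ hs]
  congr 1
  exact Finset.filter_congr fun a ha => by rw [hB a ha]

-- Any special choice of linear forms gives at most the generic rank.
open Classical in
theorem finrank_span_le_card_not_genDep [Infinite K] (L : Ideal (MvPolynomial (Fin n) K))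
    {s : Finset (Fin n →₀ ℕ)} (hs : IsInitialSeg s) (B : Fin n × Fin n → K) :
    Module.finrank K (Submodule.span K (mon (linMk L B) '' (s : Set (Fin n →₀ ℕ)))) ≤
      (s.filter fun a => ¬ GenDep L a).card := by
  obtain ⟨B', h1, h2⟩ := ((eventually_finrank_span_eq L hs).and
    (eventually_finrank_span_le s (f := fun b B => mon (linMk L B) b)
      (mon_mem_polyMaps (linMk_mem_polyMaps L)) B)).exists
  rw [← h1]
  exact h2

/-- Exchange property of generic dependence: a variable below the support of `r` may be replaced
by an even larger one. -/
theorem GenDep.exchange [Infinite K] {L : Ideal (MvPolynomial (Fin n) K)} {r : Fin n →₀ ℕ}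
    {j k : Fin n} (hjk : j < k) (hr : ∀ q, q ≤ k → r q = 0)
    (h : GenDep L (r + Finsupp.single k 1)) : GenDep L (r + Finsupp.single j 1) := by
  -- Swapping columns `j` and `k` preserves genericity, fixes `r`, and turns `r * x_k` into `r *
  -- x_j`.
  let σ : Equiv.Perm (Fin n) := Equiv.swap j k
  have hinj : Function.Injective (fun p : Fin n × Fin n => (p.1, σ p.2)) := fun p q hpq => by
    simp only [Prod.mk.injEq, σ.injective.eq_iff] at hpq
    exact Prod.ext hpq.1 hpq.2
  filter_upwards [(tendsto_genericPts_comp (K := K) hinj).eventually h] with B hB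
  have hl : linMk L (B ∘ fun p : Fin n × Fin n => (p.1, σ p.2)) = linMk L B ∘ σ := rfl
  have hσr : r.mapDomain σ = r := by
    ext q
    obtain ⟨q, rfl⟩ := σ.surjective q
    rw [Finsupp.mapDomain_apply σ.injective]
    rcases eq_or_ne q j with rfl | h1
    · simp [σ, hr q hjk.le, hr k le_rfl]
    rcases eq_or_ne q k with rfl | h2
    · simp [σ, hr q le_rfl, hr j hjk.le]
    rw [Equiv.swap_apply_of_ne_of_ne h1 h2]
  rw [hl, Dep, mon_comp _ σ.injective, Finsupp.mapDomain_add, hσr, Finsupp.mapDomain_single,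
    Equiv.swap_apply_right] at hB
  refine Submodule.span_mono ?_ hB
  rintro _ ⟨b, ⟨hd, p, hp, hlt⟩, rfl⟩
  -- If `p ≤ k`, then `b` would dominate `r + single k 1` entrywise, strictly at `p`, against the
  -- equality of degrees. So the deciding index lies beyond `k` and is untouched by the swap.
  have hkp : k < p := by
    by_contra hpk
    rw [not_lt] at hpk
    have e1 : b.degree = ∑ i, b i := Finsupp.degree_eq_sum b
    have e2 := Finsupp.degree_eq_sum (r + Finsupp.single k 1)
    have : (r + Finsupp.single k 1).degree < b.degree := by
      rw [e1, e2]
      refine Finset.sum_lt_sum (fun i _ => ?_) ⟨p, Finset.mem_univ _, hlt⟩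
      rcases lt_trichotomy p i with hi | rfl | hi
      · exact (hp i hi).ge
      · exact hlt.le
      · simp [hr i (hi.le.trans hpk), (hi.trans_le hpk).ne']
    omega
  refine ⟨b.mapDomain σ, ⟨?_, p, fun q hq => ?_, ?_⟩, (mon_comp _ σ.injective b).symm⟩
  · have : (b.mapDomain σ).degree = b.degree := by
      rw [Finsupp.degree_eq_sum, Finsupp.degree_eq_sum]
      exact (Fintype.sum_equiv σ _ _ fun i => by rw [Finsupp.mapDomain_apply σ.injective]).symm
    rw [this, hd]
    simp
  · have e : σ q = q := Equiv.swap_apply_of_ne_of_ne (hjk.trans (hkp.trans hq)).ne' (hkp.trans hq).ne'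
    have e2 := hp q hq
    nth_rewrite 1 [← e]
    rw [Finsupp.mapDomain_apply σ.injective, e2]
    simp [(hkp.trans hq).ne, (hjk.trans (hkp.trans hq)).ne]
  · have e : σ p = p := Equiv.swap_apply_of_ne_of_ne (hjk.trans hkp).ne' hkp.ne'
    nth_rewrite 2 [← e]
    rw [Finsupp.mapDomain_apply σ.injective]
    simpa [Finsupp.single_apply, hkp.ne, (hjk.trans hkp).ne] using hlt

end GenDep

/-! ### Initial ideals and dependence -/

section Initial

variable {K : Type*} [Field K] {n : ℕ}

theorem decompose_apply_eq (f : MvPolynomial (Fin n) K) (i : ℕ) :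
    (DirectSum.decompose (homogeneousSubmodule (Fin n) K) f i : MvPolynomial (Fin n) K) =
      homogeneousComponent i f :=
  MvPolynomial.decomposition.decompose'_apply f i

theorem isHomogeneous_of_homogeneousComponent_mem {L : Ideal (MvPolynomial (Fin n) K)}
    (h : ∀ f ∈ L, ∀ i, homogeneousComponent i f ∈ L) :
    L.IsHomogeneous (homogeneousSubmodule (Fin n) K) := by
  intro i f hf
  rw [decompose_apply_eq]
  exact h f hf i

/-- The residue classes of the variables. -/
noncomputable def stdMk (L : Ideal (MvPolynomial (Fin n) K)) (j : Fin n) :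
    MvPolynomial (Fin n) K ⧸ L :=
  Ideal.Quotient.mkₐ K L (X j)

theorem mon_stdMk (L : Ideal (MvPolynomial (Fin n) K)) (a : Fin n →₀ ℕ) :
    mon (stdMk L) a = Ideal.Quotient.mkₐ K L (monomial a 1) := by
  rw [← mon_X, map_mon]
  rfl

/-- A dependence of `x^a` modulo `L` is an element of `L` with leading exponent `a`. Conversely,
homogeneity lets one keep only the component of the leading degree. -/
theorem dep_stdMk_iff {L : Ideal (MvPolynomial (Fin n) K)}
    (hL : L.IsHomogeneous (homogeneousSubmodule (Fin n) K)) (a : Fin n →₀ ℕ) :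
    Dep K (stdMk L) a ↔ ∃ f ∈ L, f ≠ 0 ∧ (degRevLex (Fin n)).degree f = a := by
  constructor
  · intro h
    have hs : mon (stdMk L) '' {b | RevLt b a} = (Ideal.Quotient.mkₐ K L).toLinearMap ''
        ((fun b => monomial b (1 : K)) '' {b | RevLt b a}) := by
      rw [← Set.image_comp]
      exact Set.image_congr fun b _ => mon_stdMk L b
    rw [Dep, hs, ← Submodule.map_span, mon_stdMk] at h
    obtain ⟨u, hu, hua⟩ := h
    have hcoeff : ∀ c, ¬ RevLt c a → coeff c u = 0 := by
      intro c hc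
      clear hua
      induction hu using Submodule.span_induction with
      | mem x hx =>
        obtain ⟨b, hb, rfl⟩ := hx
        rw [coeff_monomial, if_neg]
        rintro rfl
        exact hc hb
      | zero => simp
      | add x y _ _ hx hy => rw [coeff_add, hx, hy, add_zero]
      | smul k x _ hx => rw [coeff_smul, hx, smul_zero]
    have hca : coeff a (monomial a 1 - u) = 1 := by
      rw [coeff_sub, coeff_monomial, if_pos rfl, hcoeff a (not_revLt_self a), sub_zero]
    refine ⟨monomial a 1 - u, ?_, fun h0 => by simp [h0] at hca, ?_⟩
    · rw [← Ideal.Quotient.eq_zero_iff_mem]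
      change Ideal.Quotient.mkₐ K L _ = 0
      rw [map_sub, sub_eq_zero]
      exact hua.symm
    · apply (degRevLex (Fin n)).toSyn.injective
      refine le_antisymm ?_ ((degRevLex (Fin n)).le_degree ?_)
      · rw [MonomialOrder.degree_le_iff]
        intro c hc
        by_cases hr : RevLt c a
        · exact (revLt_iff.1 hr).2.le
        · rw [mem_support_iff, coeff_sub, hcoeff c hr, sub_zero, coeff_monomial] at hc
          have : a = c := by by_contra hne; simp [hne] at hc
          rw [this]
      · rw [mem_support_iff, hca]
        exact one_ne_zero
  · rintro ⟨f, hf, hf0, rfl⟩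
    set a := (degRevLex (Fin n)).degree f with ha
    set g := homogeneousComponent a.degree f with hg
    have hgL : g ∈ L := homogeneousComponent_mem_of_mem hL hf _
    have hga : coeff a g ≠ 0 := by
      rw [hg, coeff_homogeneousComponent, if_pos rfl]
      exact (degRevLex (Fin n)).coeff_degree_ne_zero_iff.2 hf0
    have hsum : Ideal.Quotient.mkₐ K L g = 0 := Ideal.Quotient.eq_zero_iff_mem.2 hgL
    rw [g.as_sum, map_sum, ← Finset.add_sum_erase _ _ (mem_support_iff.2 hga)] at hsum
    have hsm : ∀ b, Ideal.Quotient.mkₐ K L (monomial b (coeff b g)) =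
        coeff b g • mon (stdMk L) b := fun b => by
      rw [mon_stdMk, ← map_smul, smul_monomial, smul_eq_mul, mul_one]
    rw [hsm, add_eq_zero_iff_eq_neg] at hsum
    rw [Dep, ← Submodule.smul_mem_iff _ hga, hsum]
    refine Submodule.neg_mem _ (Submodule.sum_mem _ fun b hb => ?_)
    rw [hsm]
    refine Submodule.smul_mem _ _ (Submodule.subset_span ⟨b, ?_, rfl⟩)
    obtain ⟨hba, hb⟩ := Finset.mem_erase.1 hb
    rw [mem_support_iff, hg, coeff_homogeneousComponent] at hb
    have hdeg : b.degree = a.degree := by by_contra hne; simp [hne] at hb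
    rw [if_pos hdeg] at hb
    refine revLt_iff.2 ⟨hdeg, lt_of_le_of_ne ?_ fun h => hba (DegRevLex.of.injective h)⟩
    exact (degRevLex (Fin n)).le_degree (mem_support_iff.2 hb)

variable (K) in
/-- The ideal generated by the monomials with exponents in a given set. -/
noncomputable def monIdeal (D : Set (Fin n →₀ ℕ)) : Ideal (MvPolynomial (Fin n) K) :=
  Ideal.span ((fun a => monomial a 1) '' D)

theorem monomial_mem_monIdeal {D : Set (Fin n →₀ ℕ)} (hD : IsUpperSet D) (a : Fin n →₀ ℕ) :
    monomial a 1 ∈ monIdeal K D ↔ a ∈ D := by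
  rw [monIdeal, mem_ideal_span_monomial_image]
  constructor
  · intro h
    obtain ⟨b, hb, hba⟩ := h a (by simp)
    exact hD hba hb
  · intro h b hb
    have : b = a := by
      by_contra hne
      exact (mem_support_iff.1 hb) (by rw [coeff_monomial, if_neg (Ne.symm hne)])
    exact ⟨a, h, this.ge⟩

theorem monIdeal_isHomogeneous (D : Set (Fin n →₀ ℕ)) :
    (monIdeal K D).IsHomogeneous (homogeneousSubmodule (Fin n) K) := by
  apply Ideal.homogeneous_span
  rintro _ ⟨a, -, rfl⟩
  exact ⟨a.degree, isHomogeneous_monomial _ rfl⟩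

theorem initialIdeal_eq {L : Ideal (MvPolynomial (Fin n) K)}
    (hL : L.IsHomogeneous (homogeneousSubmodule (Fin n) K)) :
    initialIdeal L = monIdeal K {a | Dep K (stdMk L) a} := by
  rw [initialIdeal, MonomialOrder.span_leadingTerm_eq_span_monomial', monIdeal]
  congr 1
  ext p
  simp only [Set.mem_image, Set.mem_sdiff, Set.mem_singleton_iff, SetLike.mem_coe,
    Set.mem_ofPred_eq, dep_stdMk_iff hL]
  constructor
  · rintro ⟨f, ⟨hf, hf0⟩, rfl⟩
    exact ⟨_, ⟨f, hf, hf0, rfl⟩, rfl⟩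
  · rintro ⟨_, ⟨f, hf, hf0, rfl⟩, rfl⟩
    exact ⟨f, ⟨hf, hf0⟩, rfl⟩

/-! ### Linear substitutions -/

/-- The substitution `x_j ↦ ∑ i, B i j * x_i`. -/
noncomputable def linHom (B : Matrix (Fin n) (Fin n) K) :
    MvPolynomial (Fin n) K →ₐ[K] MvPolynomial (Fin n) K :=
  aeval (lin fun p => B p.1 p.2)

theorem linHom_lin (A : Matrix (Fin n) (Fin n) K) (B : Fin n × Fin n → K) (j : Fin n) :
    linHom A (lin B j) = lin (fun p => (A * toMat B) p.1 p.2) j := by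
  simp only [linHom, lin, map_sum, map_mul, algHom_C, algebraMap_eq, aeval_X, Matrix.mul_apply,
    Finset.mul_sum, Finset.sum_mul, Matrix.of_apply]
  rw [Finset.sum_comm]
  refine Finset.sum_congr rfl fun i _ => Finset.sum_congr rfl fun k _ => ?_
  ring

theorem lin_one (j : Fin n) : lin (fun p => (1 : Matrix (Fin n) (Fin n) K) p.1 p.2) j = X j := by
  rw [lin, Finset.sum_eq_single j]
  · simp
  · intro i _ hi
    simp [hi]
  · simp

theorem linHom_X (B : Matrix (Fin n) (Fin n) K) (j : Fin n) :
    linHom B (X j) = lin (fun p => B p.1 p.2) j := by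
  simp [linHom]

theorem linHom_comp (A B : Matrix (Fin n) (Fin n) K) :
    (linHom A).comp (linHom B) = linHom (A * B) := by
  ext1 j
  rw [AlgHom.comp_apply, linHom_X, linHom_X, linHom_lin]
  rfl

theorem linHom_one : linHom (1 : Matrix (Fin n) (Fin n) K) = AlgHom.id K _ := by
  ext1 j
  rw [linHom_X, lin_one, AlgHom.id_apply]

/-- The linear substitution of an invertible matrix as an automorphism. -/
noncomputable def linEquiv (A : Matrix (Fin n) (Fin n) K) (hA : IsUnit A.det) :
    MvPolynomial (Fin n) K ≃ₐ[K] MvPolynomial (Fin n) K :=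
  AlgEquiv.ofAlgHom (linHom A) (linHom A⁻¹)
    (by rw [linHom_comp, Matrix.mul_nonsing_inv _ hA, linHom_one])
    (by rw [linHom_comp, Matrix.nonsing_inv_mul _ hA, linHom_one])

theorem isHomogeneous_lin (B : Fin n × Fin n → K) (j : Fin n) : (lin B j).IsHomogeneous 1 := by
  refine IsHomogeneous.sum _ _ _ fun i _ => ?_
  simpa using (isHomogeneous_C (Fin n) (B (i, j))).mul (isHomogeneous_X K i)

theorem isHomogeneous_linHom (A : Matrix (Fin n) (Fin n) K) {f : MvPolynomial (Fin n) K} {d : ℕ}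
    (hf : f.IsHomogeneous d) : (linHom A f).IsHomogeneous d := by
  rw [← one_mul d]
  exact hf.aeval (n := 1) _ fun j => isHomogeneous_lin _ j

theorem homogeneousComponent_linHom (A : Matrix (Fin n) (Fin n) K) (f : MvPolynomial (Fin n) K)
    (i : ℕ) : homogeneousComponent i (linHom A f) = linHom A (homogeneousComponent i f) := by
  conv_lhs => rw [← sum_homogeneousComponent f, map_sum, map_sum]
  have : ∀ k, homogeneousComponent i (linHom A (homogeneousComponent k f)) =
      if k = i then linHom A (homogeneousComponent i f) else 0 := by
    intro k
    rw [homogeneousComponent_of_mem (isHomogeneous_linHom A (homogeneousComponent_isHomogeneous k f))]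
    split_ifs with h1 h2 h2
    · rw [h2]
    · exact absurd h1.symm h2
    · exact absurd h2.symm h1
    · rfl
  simp only [this, Finset.sum_ite_eq', Finset.mem_range]
  split_ifs with h
  · rfl
  · rw [homogeneousComponent_eq_zero _ _ (by omega), map_zero]

theorem mem_map_linHom {A : Matrix (Fin n) (Fin n) K} (hA : IsUnit A.det)
    (L : Ideal (MvPolynomial (Fin n) K)) (f : MvPolynomial (Fin n) K) :
    linHom A f ∈ L.map (linHom A) ↔ f ∈ L := by
  constructor
  · intro h
    obtain ⟨g, hg, hgf⟩ := (Ideal.mem_map_iff_of_surjective (linHom A)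
      (linEquiv A hA).surjective).1 h
    rwa [← (linEquiv A hA).injective hgf]
  · exact Ideal.mem_map_of_mem _

theorem isHomogeneous_map_linHom {A : Matrix (Fin n) (Fin n) K} (hA : IsUnit A.det)
    {L : Ideal (MvPolynomial (Fin n) K)} (hL : L.IsHomogeneous (homogeneousSubmodule (Fin n) K)) :
    (L.map (linHom A)).IsHomogeneous (homogeneousSubmodule (Fin n) K) := by
  refine isHomogeneous_of_homogeneousComponent_mem fun f hf i => ?_
  obtain ⟨g, rfl⟩ := (linEquiv A hA).surjective f
  change homogeneousComponent i (linHom A g) ∈ _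
  rw [homogeneousComponent_linHom]
  exact Ideal.mem_map_of_mem _ (homogeneousComponent_mem_of_mem hL ((mem_map_linHom hA L g).1 hf) i)

/-- The automorphism `linHom A` carries `L` to its image and the forms of `B` to those of `A * B`,
so it transports relations in both directions. -/
theorem dep_linMk_map_linHom {A : Matrix (Fin n) (Fin n) K} (hA : IsUnit A.det)
    (L : Ideal (MvPolynomial (Fin n) K)) (B : Fin n × Fin n → K) (a : Fin n →₀ ℕ) :
    Dep K (linMk (L.map (linHom A)) fun p => (A * toMat B) p.1 p.2) a ↔ Dep K (linMk L B) a := by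
  have h := mem_span_image_congr (Ideal.Quotient.mkₐ K L).toLinearMap
    ((Ideal.Quotient.mkₐ K (L.map (linHom A))).comp (linHom A)).toLinearMap ⊤
    (fun u _ => by
      change Ideal.Quotient.mk _ u = 0 ↔ Ideal.Quotient.mk _ (linHom A u) = 0
      rw [Ideal.Quotient.eq_zero_iff_mem, Ideal.Quotient.eq_zero_iff_mem, mem_map_linHom hA])
    (mon (lin B)) (s := {b | RevLt b a}) (fun _ _ => trivial) (u := mon (lin B) a) trivial
  simp only [AlgHom.toLinearMap_apply, map_mon, AlgHom.comp_apply, linHom_lin] at h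
  exact h.symm

/-- The bridge from initial ideals to linear forms: relations among the variables after a change of
coordinates are relations among the columns of the inverse matrix before it. -/
theorem dep_stdMk_map_linHom {A : Matrix (Fin n) (Fin n) K} (hA : IsUnit A.det)
    (L : Ideal (MvPolynomial (Fin n) K)) (a : Fin n →₀ ℕ) :
    Dep K (stdMk (L.map (linHom A))) a ↔ Dep K (linMk L fun p => A⁻¹ p.1 p.2) a := by
  rw [← dep_linMk_map_linHom hA]
  have h1 : toMat (fun p : Fin n × Fin n => A⁻¹ p.1 p.2) = A⁻¹ := rfl
  have : (linMk (L.map (linHom A)) fun p => (A * A⁻¹) p.1 p.2) = stdMk (L.map (linHom A)) := by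
    funext j
    rw [linMk, Matrix.mul_nonsing_inv _ hA, lin_one, stdMk]
  rw [h1, this]

theorem span_mon_lin_degFinset {B : Fin n × Fin n → K} (hB : (toMat B).det ≠ 0) (d : ℕ) :
    Submodule.span K (mon (lin B) '' (degFinset n d : Set (Fin n →₀ ℕ))) =
      homogeneousSubmodule (Fin n) K d := by
  apply le_antisymm
  · rw [Submodule.span_le]
    rintro _ ⟨a, ha, rfl⟩
    rw [Finset.mem_coe, mem_degFinset] at ha
    have h := isHomogeneous_linHom (toMat B) (isHomogeneous_monomial (1 : K) ha)
    rw [← mon_X, map_mon] at h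
    simp only [linHom_X] at h
    exact h
  · intro g hg
    have h1 := isHomogeneous_linHom (toMat B)⁻¹ hg
    set h := linHom (toMat B)⁻¹ g with hh
    have h2 : linHom (toMat B) h = g := (linEquiv _ hB.isUnit).apply_symm_apply g
    rw [← h2, h.as_sum, map_sum]
    refine Submodule.sum_mem _ fun b hb => ?_
    have h3 : linHom (toMat B) (monomial b (coeff b h)) = coeff b h • mon (lin B) b := by
      have : monomial b (coeff b h) = coeff b h • mon (X : Fin n → MvPolynomial (Fin n) K) b := by
        rw [mon_X, smul_monomial, smul_eq_mul, mul_one]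
      rw [this, map_smul, map_mon]
      simp only [linHom_X]
      rfl
    rw [h3]
    refine Submodule.smul_mem _ _ (Submodule.subset_span ⟨b, ?_, rfl⟩)
    rw [Finset.mem_coe, mem_degFinset]
    have := h1 (mem_support_iff.1 hb)
    rw [Finsupp.degree_eq_weight_one]
    exact this

/-! ### Existence of generic initial ideals -/

theorem span_mon_linMk (L : Ideal (MvPolynomial (Fin n) K)) (B : Fin n × Fin n → K)
    (s : Set (Fin n →₀ ℕ)) :
    Submodule.span K (mon (linMk L B) '' s) =
      (Submodule.span K (mon (lin B) '' s)).map (Ideal.Quotient.mkₐ K L).toLinearMap := by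
  rw [Submodule.map_span, ← Set.image_comp]
  congr 1
  exact Set.image_congr fun b _ => (map_mon (Ideal.Quotient.mkₐ K L) _ b).symm

/-- One open set works for all exponents. By Dickson's lemma only finitely many minimal exponents
have to be made dependent. No further dependence can occur, because for invertible `B` the number of
independent monomials in each degree is the dimension of the image of that degree in the quotient by
`L`. -/
theorem eventually_forall_dep_iff_genDep [Infinite K] (L : Ideal (MvPolynomial (Fin n) K)) :
    ∀ᶠ B in genericPts (Fin n × Fin n) K, ∀ a, Dep K (linMk L B) a ↔ GenDep L a := by
  classical
  have hfin : {a | Minimal (GenDep L) a}.Finite :=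
    WellQuasiOrderedLE.finite_of_isAntichain (setOfPred_minimal_antichain _)
  have hmin : ∀ᶠ B in genericPts (Fin n × Fin n) K, ∀ a ∈ {a | Minimal (GenDep L) a},
      Dep K (linMk L B) a :=
    (Filter.eventually_all_finite hfin).2 fun a ha => ha.1
  filter_upwards [hmin, eventually_det_ne_zero n] with B hB hdet a
  have himp : ∀ a, GenDep L a → Dep K (linMk L B) a := by
    intro a ha
    obtain ⟨b, hba, hb⟩ := exists_minimal_le_of_wellFoundedLT (GenDep L) a ha
    exact (hB b hb).mono hba
  refine ⟨fun hD => ?_, himp a⟩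
  obtain ⟨B', h1, h2⟩ := ((eventually_finrank_span_eq L (isInitialSeg_degFinset a.degree)).and
    (eventually_det_ne_zero n)).exists
  have h3 := card_filter_not_dep (K := K) (linMk L B) (isInitialSeg_degFinset a.degree)
  rw [span_mon_linMk, span_mon_lin_degFinset hdet] at h3
  rw [span_mon_linMk, span_mon_lin_degFinset h2, ← h3] at h1
  have hsub : ((degFinset n a.degree).filter fun a => ¬ Dep K (linMk L B) a) ⊆
      (degFinset n a.degree).filter fun a => ¬ GenDep L a :=
    Finset.monotone_filter_right _ fun b _ hb hb' => hb (himp b hb')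
  have heq := Finset.eq_of_subset_of_card_le hsub h1.ge
  by_contra hG
  have : a ∈ (degFinset n a.degree).filter fun a => ¬ GenDep L a := by simp [hG]
  rw [← heq, Finset.mem_filter] at this
  exact this.2 hD

theorem isGin_monIdeal_genDep [Infinite K] {L : Ideal (MvPolynomial (Fin n) K)}
    (hL : L.IsHomogeneous (homogeneousSubmodule (Fin n) K)) :
    IsGin L (monIdeal K {a | GenDep L a}) := by
  obtain ⟨P, hP, h⟩ := (tendsto_genericPts_inv (K := K) n).eventually
    (eventually_forall_dep_iff_genDep L)
  refine ⟨P, hP, fun A hA => ?_⟩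
  have hu : IsUnit (A : Matrix (Fin n) (Fin n) K).det := (Matrix.isUnit_iff_isUnit_det _).1 A.isUnit
  have h1 : linearChange A = linHom (A : Matrix (Fin n) (Fin n) K) := rfl
  rw [h1, initialIdeal_eq (isHomogeneous_map_linHom hu hL)]
  congr 1
  ext a
  rw [Set.mem_ofPred_eq, dep_stdMk_map_linHom hu]
  exact h _ hA a

theorem isGin_gin [Infinite K] {L : Ideal (MvPolynomial (Fin n) K)}
    (hL : L.IsHomogeneous (homogeneousSubmodule (Fin n) K)) : IsGin L (gin L) :=
  Classical.epsilon_spec (p := IsGin L) ⟨_, isGin_monIdeal_genDep hL⟩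

theorem gin_eq [Infinite K] {L : Ideal (MvPolynomial (Fin n) K)}
    (hL : L.IsHomogeneous (homogeneousSubmodule (Fin n) K)) :
    gin L = monIdeal K {a | GenDep L a} :=
  (isGin_gin hL).unique (isGin_monIdeal_genDep hL)

theorem gin_isHomogeneous [Infinite K] {L : Ideal (MvPolynomial (Fin n) K)}
    (hL : L.IsHomogeneous (homogeneousSubmodule (Fin n) K)) :
    (gin L).IsHomogeneous (homogeneousSubmodule (Fin n) K) := by
  rw [gin_eq hL]
  exact monIdeal_isHomogeneous _

theorem monomial_mem_gin [Infinite K] {L : Ideal (MvPolynomial (Fin n) K)}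
    (hL : L.IsHomogeneous (homogeneousSubmodule (Fin n) K)) (a : Fin n →₀ ℕ) :
    monomial a 1 ∈ gin L ↔ GenDep L a := by
  rw [gin_eq hL]
  exact monomial_mem_monIdeal (fun _ _ hab ha => GenDep.mono ha hab) a

theorem dep_linMk_zero_iff {L : Ideal (MvPolynomial (Fin n) K)} {B : Fin n × Fin n → K} :
    Dep K (linMk L B) 0 ↔ L = ⊤ := by
  have he : {b : Fin n →₀ ℕ | RevLt b 0} = ∅ := by
    refine Set.eq_empty_of_forall_notMem fun b hb => ?_
    have h1 : b = 0 := (Finsupp.degree_eq_zero_iff b).1 (by simpa using hb.1)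
    exact not_revLt_self 0 (h1 ▸ hb)
  rw [Dep, mon_zero, he, Set.image_empty, Submodule.span_empty, Submodule.mem_bot,
    Ideal.eq_top_iff_one]
  exact Ideal.Quotient.eq_zero_iff_mem

theorem genDep_zero_iff [Infinite K] {L : Ideal (MvPolynomial (Fin n) K)} :
    GenDep L 0 ↔ L = ⊤ := by
  simp only [GenDep, dep_linMk_zero_iff, Filter.eventually_const]

theorem gin_eq_top_iff [Infinite K] {L : Ideal (MvPolynomial (Fin n) K)}
    (hL : L.IsHomogeneous (homogeneousSubmodule (Fin n) K)) : gin L = ⊤ ↔ L = ⊤ := by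
  rw [← genDep_zero_iff (L := L), ← monomial_mem_gin hL, Ideal.eq_top_iff_one]
  rfl

end Initial

/-! ### Degeneration to the initial ideal -/

section Degeneration

variable {K : Type*} [Field K] {n : ℕ}

theorem dep_stdMk_monIdeal {D : Set (Fin n →₀ ℕ)} (hD : IsUpperSet D) (a : Fin n →₀ ℕ) :
    Dep K (stdMk (monIdeal K D)) a ↔ a ∈ D := by
  rw [dep_stdMk_iff (monIdeal_isHomogeneous D)]
  constructor
  · rintro ⟨f, hf, hf0, rfl⟩
    rw [monIdeal, mem_ideal_span_monomial_image] at hf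
    obtain ⟨b, hb, hba⟩ := hf _ ((degRevLex (Fin n)).degree_mem_support_iff f |>.2 hf0)
    exact hD hba hb
  · intro ha
    refine ⟨monomial a 1, (monomial_mem_monIdeal hD a).2 ha, by simp, ?_⟩
    classical
    rw [MonomialOrder.degree_monomial, if_neg one_ne_zero]

/-- A weight representing the reverse lexicographic order in degree `d`. -/
def revWeight (d : ℕ) (a : Fin n →₀ ℕ) : ℕ := ∑ i : Fin n, a i * (d + 1) ^ (i : ℕ)

/-- The weight reads the exponents as digits in base `d + 1`, the last variable leading. Digits of a
degree `d` monomial are at most `d`, so the highest differing digit decides. -/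
theorem RevLt.revWeight_lt {d : ℕ} {b a : Fin n →₀ ℕ} (h : RevLt b a) (hd : a.degree = d) :
    revWeight d a < revWeight d b := by
  obtain ⟨-, i, hi, hlt⟩ := h
  have hsplit : ∀ c : Fin n →₀ ℕ, revWeight d c =
      ∑ j ∈ Finset.univ.filter (· < i), c j * (d + 1) ^ (j : ℕ) +
      ∑ j ∈ Finset.univ.filter (¬ · < i), c j * (d + 1) ^ (j : ℕ) := fun c =>
    (Finset.sum_filter_add_sum_filter_not _ _ _).symm
  have h1 : (d + 1) * ∑ j ∈ Finset.univ.filter (· < i), a j * (d + 1) ^ (j : ℕ) ≤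
      d * (d + 1) ^ (i : ℕ) := by
    calc _ = ∑ j ∈ Finset.univ.filter (· < i), a j * (d + 1) ^ ((j : ℕ) + 1) := by
          rw [Finset.mul_sum]
          exact Finset.sum_congr rfl fun j _ => by ring
      _ ≤ ∑ j ∈ Finset.univ.filter (· < i), a j * (d + 1) ^ (i : ℕ) := by
          refine Finset.sum_le_sum fun j hj => Nat.mul_le_mul_left _ ?_
          refine Nat.pow_le_pow_right (Nat.succ_pos d) ?_
          exact (Finset.mem_filter.1 hj).2
      _ = (∑ j ∈ Finset.univ.filter (· < i), a j) * (d + 1) ^ (i : ℕ) := by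
          rw [Finset.sum_mul]
      _ ≤ _ := by
          refine Nat.mul_le_mul_right _ ?_
          rw [← hd, Finsupp.degree_eq_sum]
          exact Finset.sum_le_sum_of_subset (Finset.filter_subset _ _)
  have h2 : ∑ j ∈ Finset.univ.filter (¬ · < i), a j * (d + 1) ^ (j : ℕ) + (d + 1) ^ (i : ℕ) ≤
      ∑ j ∈ Finset.univ.filter (¬ · < i), b j * (d + 1) ^ (j : ℕ) := by
    have hmem : i ∈ Finset.univ.filter (¬ · < i) := by simp
    rw [← Finset.add_sum_erase _ _ hmem, ← Finset.add_sum_erase _ (fun j => b j * _) hmem]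
    have : ∑ j ∈ (Finset.univ.filter (¬ · < i)).erase i, a j * (d + 1) ^ (j : ℕ) =
        ∑ j ∈ (Finset.univ.filter (¬ · < i)).erase i, b j * (d + 1) ^ (j : ℕ) := by
      refine Finset.sum_congr rfl fun j hj => ?_
      simp only [Finset.mem_erase, Finset.mem_filter, Finset.mem_univ, true_and, not_lt] at hj
      rw [hi j (lt_of_le_of_ne hj.2 hj.1.symm)]
    rw [this]
    nlinarith [Nat.mul_le_mul_right ((d + 1) ^ (i : ℕ)) (Nat.succ_le_of_lt hlt)]
  have h3 : 0 < (d + 1) ^ (i : ℕ) := by positivity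
  rw [hsplit a, hsplit b]
  have h4 : ∑ j ∈ Finset.univ.filter (· < i), a j * (d + 1) ^ (j : ℕ) < (d + 1) ^ (i : ℕ) := by
    by_contra hc
    rw [not_lt] at hc
    have := Nat.mul_le_mul_left (d + 1) hc
    nlinarith
  omega

/-- Repeated rewriting of dependent monomials by smaller ones terminates, since the order is well
founded. -/
theorem mon_mem_span_not_dep {R : Type*} [CommRing R] [Algebra K R] (l : Fin n → R)
    (a : Fin n →₀ ℕ) :
    mon l a ∈ Submodule.span K (mon l '' {b | ¬ Dep K l b ∧ (b = a ∨ RevLt b a)}) := by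
  induction a using wellFounded_revLt.induction with
  | _ a ih =>
    by_cases h : Dep K l a
    · refine Submodule.span_le.2 ?_ h
      rintro _ ⟨b, hb, rfl⟩
      refine Submodule.span_mono (Set.image_mono ?_) (ih b hb)
      rintro c ⟨hc, rfl | hcb⟩
      exacts [⟨hc, Or.inr hb⟩, ⟨hc, Or.inr (hcb.trans hb)⟩]
    · exact Submodule.subset_span ⟨a, ⟨h, Or.inl rfl⟩, rfl⟩

/-- The largest monomial in a nontrivial relation would be dependent. -/
theorem eq_zero_of_sum_smul_mon_eq_zero {R : Type*} [CommRing R] [Algebra K R] {l : Fin n → R}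
    {d : ℕ} (g : (Fin n →₀ ℕ) →₀ K) (hd : ∀ b ∈ g.support, b.degree = d)
    (hg : ∀ b ∈ g.support, ¬ Dep K l b) (h : g.sum (fun b c => c • mon l b) = 0) : g = 0 := by
  classical
  by_contra hne
  obtain ⟨b, hb, hmax⟩ := g.support.exists_max_image DegRevLex.of
    (Finsupp.support_nonempty_iff.2 hne)
  apply hg b hb
  rw [Finsupp.sum, ← Finset.add_sum_erase _ _ hb, add_eq_zero_iff_eq_neg] at h
  rw [Dep, ← Submodule.smul_mem_iff _ (Finsupp.mem_support_iff.1 hb), h]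
  refine Submodule.neg_mem _ (Submodule.sum_mem _ fun c hc => Submodule.smul_mem _ _
    (Submodule.subset_span ⟨c, ?_, rfl⟩))
  obtain ⟨hcb, hc⟩ := Finset.mem_erase.1 hc
  exact revLt_iff.2 ⟨(hd c hc).trans (hd b hb).symm,
    lt_of_le_of_ne (hmax c hc) fun h => hcb (DegRevLex.of.injective h)⟩

/-- Coefficients of the normal form of `x^a` modulo `L`. -/
theorem exists_normalForm (L : Ideal (MvPolynomial (Fin n) K)) (a : Fin n →₀ ℕ) :
    ∃ c : (Fin n →₀ ℕ) →₀ K, c.sum (fun b k => k • mon (stdMk L) b) = mon (stdMk L) a ∧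
      (∀ b ∈ c.support, ¬ Dep K (stdMk L) b ∧ (b = a ∨ RevLt b a)) ∧
      (¬ Dep K (stdMk L) a → c = Finsupp.single a 1) := by
  by_cases h : Dep K (stdMk L) a
  · have := mon_mem_span_not_dep (K := K) (stdMk L) a
    rw [Finsupp.mem_span_image_iff_linearCombination] at this
    obtain ⟨c, hc, hca⟩ := this
    exact ⟨c, hca, fun b hb => hc hb, fun h' => absurd h h'⟩
  · refine ⟨Finsupp.single a 1, by simp, fun b hb => ?_, fun _ => rfl⟩
    have : b = a := by
      by_contra hne
      exact (Finsupp.mem_support_iff.1 hb) (Finsupp.single_eq_of_ne hne)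
    exact ⟨this ▸ h, Or.inl this⟩

theorem finrank_map_le_finrank_map {V W W' : Type*} [AddCommGroup V] [Module K V] [AddCommGroup W]
    [Module K W] [AddCommGroup W'] [Module K W'] (f : V →ₗ[K] W) (g : V →ₗ[K] W')
    (U : Submodule K V) [FiniteDimensional K U] (h : ∀ u ∈ U, g u = 0 → f u = 0) :
    Module.finrank K (U.map f) ≤ Module.finrank K (U.map g) := by
  have h1 := (f.domRestrict U).finrank_range_add_finrank_ker
  have h2 := (g.domRestrict U).finrank_range_add_finrank_ker
  rw [LinearMap.range_domRestrict] at h1 h2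
  have h3 : Module.finrank K (LinearMap.ker (g.domRestrict U)) ≤
      Module.finrank K (LinearMap.ker (f.domRestrict U)) := by
    refine Submodule.finrank_mono fun u hu => ?_
    exact h u u.2 hu
  omega

/-- The diagonal substitution `x_i ↦ t ^ ((d + 1) ^ i) * x_i`. -/
noncomputable def torusMat (n d : ℕ) (t : K) : Matrix (Fin n) (Fin n) K :=
  Matrix.diagonal fun i => t ^ ((d + 1) ^ (i : ℕ))

theorem linHom_torusMat (d : ℕ) (t : K) (a : Fin n →₀ ℕ) :
    linHom (torusMat n d t) (monomial a 1) = t ^ revWeight d a • monomial a 1 := by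
  have hl : ∀ j, lin (fun p => torusMat n d t p.1 p.2) j =
      t ^ ((d + 1) ^ (j : ℕ)) • (X j : MvPolynomial (Fin n) K) := by
    intro j
    rw [lin, Finset.sum_eq_single j]
    · simp [torusMat, smul_eq_C_mul]
    · intro i _ hi
      simp [torusMat, Matrix.diagonal_apply_ne _ hi]
    · simp
  rw [← mon_X, map_mon]
  simp only [linHom_X, hl, mon, smul_pow, Finset.prod_smul, ← pow_mul, Finset.prod_pow_eq_pow_sum,
    revWeight, mul_comm]

-- Conjugating the normal form map of `L` by the torus gives a polynomial family `N t` whose member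
-- at `t = 0` is the normal form modulo the initial ideal. Semicontinuity at `t = 0` bounds the rank
-- modulo the initial ideal by the rank modulo `L` of torus-translated forms, hence by the generic
-- rank.
open Classical in
theorem card_not_genDep_monIdeal_le [Infinite K] (L : Ideal (MvPolynomial (Fin n) K))
    {s : Finset (Fin n →₀ ℕ)} (hs : IsInitialSeg s) :
    (s.filter fun a => ¬ GenDep (monIdeal K {a | Dep K (stdMk L) a}) a).card ≤
      (s.filter fun a => ¬ GenDep L a).card := by
  set D : Set (Fin n →₀ ℕ) := {a | Dep K (stdMk L) a} with hD
  set G := monIdeal K D with hG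
  obtain ⟨d, hd⟩ : ∃ d, ∀ a ∈ s, a.degree = d := by
    rcases s.eq_empty_or_nonempty with rfl | ⟨a, ha⟩
    · exact ⟨0, by simp⟩
    · exact ⟨a.degree, fun b hb => hs.degree_eq b hb a ha⟩
  obtain ⟨B, hB⟩ := (eventually_finrank_span_eq G hs).exists
  rw [← hB]
  choose c hc1 hc2 hc3 using exists_normalForm L
  -- the family of normal form maps, with limit the normal form modulo the initial ideal
  let ν : K → (Fin n →₀ ℕ) → MvPolynomial (Fin n) K := fun t a =>
    (c a).sum fun b k => (k * t ^ (revWeight d b - revWeight d a)) • monomial b 1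
  let N : K → MvPolynomial (Fin n) K →ₗ[K] MvPolynomial (Fin n) K := fun t =>
    (basisMonomials (Fin n) K).constr K (ν t)
  let NF : MvPolynomial (Fin n) K →ₗ[K] MvPolynomial (Fin n) K :=
    (basisMonomials (Fin n) K).constr K fun a => (c a).sum fun b k => k • monomial b 1
  have hN : ∀ t a, N t (monomial a 1) = ν t a := fun t a => by
    have := (basisMonomials (Fin n) K).constr_basis K (ν t) a
    rwa [coe_basisMonomials] at this
  have hNF : ∀ a, NF (monomial a 1) = (c a).sum fun b k => k • monomial b 1 := fun a => by
    have := (basisMonomials (Fin n) K).constr_basis K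
      (fun a => (c a).sum fun b k => k • monomial b (1 : K)) a
    rwa [coe_basisMonomials] at this
  have has_sum : ∀ u : MvPolynomial (Fin n) K, u = ∑ a ∈ u.support, coeff a u • monomial a 1 :=
    fun u => by
      conv_lhs => rw [u.as_sum]
      exact Finset.sum_congr rfl fun a _ => by rw [smul_monomial, smul_eq_mul, mul_one]
  set U := Submodule.span K (mon (lin B) '' (s : Set (Fin n →₀ ℕ))) with hU
  have : FiniteDimensional K U := FiniteDimensional.span_of_finite K (s.finite_toSet.image _)
  have hUd : ∀ u ∈ U, u.IsHomogeneous d := by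
    have : U ≤ homogeneousSubmodule (Fin n) K d := by
      rw [hU, Submodule.span_le]
      rintro _ ⟨a, ha, rfl⟩
      have h := isHomogeneous_linHom (toMat B) (isHomogeneous_monomial (1 : K) (hd a ha))
      rw [← mon_X, map_mon] at h
      simp only [linHom_X] at h
      exact h
    exact fun u hu => this hu
  have hdeg : ∀ u : MvPolynomial (Fin n) K, u.IsHomogeneous d → ∀ a ∈ u.support, a.degree = d := by
    intro u hu a ha
    have := hu (mem_support_iff.1 ha)
    rw [Finsupp.degree_eq_weight_one]
    exact this
  -- the normal form at `t = 0` has kernel inside `G`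
  have h0 : ∀ u ∈ U, N 0 u = 0 → (Ideal.Quotient.mkₐ K G).toLinearMap u = 0 := by
    intro u hu hu0
    have hν : ∀ a ∈ u.support, ν 0 a = if a ∈ D then 0 else monomial a 1 := by
      intro a ha
      -- For dependent `a`, every term of the normal form is strictly smaller, so its power of `t`
      -- is positive and vanishes at 0.
      split_ifs with haD
      · refine Finset.sum_eq_zero fun b hb => ?_
        obtain ⟨hb1, rfl | hb2⟩ := hc2 a b hb
        · exact absurd haD hb1
        · have := hb2.revWeight_lt (hdeg u (hUd u hu) a ha)
          simp only
          rw [zero_pow (by omega), mul_zero, zero_smul]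
      · simp [ν, hc3 a haD]
    have hmem : ∀ a ∈ u.support, a ∈ D := by
      intro a ha
      by_contra haD
      have h1 := congrArg (coeff a) hu0
      rw [has_sum u, map_sum, coeff_sum, Finset.sum_eq_single a] at h1
      · rw [map_smul, hN, hν a ha, if_neg haD, coeff_smul, coeff_monomial, if_pos rfl, smul_eq_mul,
          mul_one, coeff_zero] at h1
        exact mem_support_iff.1 ha h1
      · intro b hb hba
        rw [map_smul, hN, hν b hb, coeff_smul]
        split_ifs
        · simp
        · rw [coeff_monomial, if_neg hba, smul_zero]
      · exact fun h => absurd ha h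
    refine Ideal.Quotient.eq_zero_iff_mem.2 ?_
    rw [has_sum u]
    refine Submodule.sum_mem _ fun a ha => ?_
    rw [smul_eq_C_mul]
    exact Ideal.mul_mem_left _ _ (Ideal.subset_span ⟨a, hmem a ha, rfl⟩)
  -- normal forms detect membership in `L`
  have hL0 : ∀ u : MvPolynomial (Fin n) K, u.IsHomogeneous d →
      Ideal.Quotient.mkₐ K L u = 0 → NF u = 0 := by
    intro u hu hmk
    let g : (Fin n →₀ ℕ) →₀ K := ∑ a ∈ u.support, coeff a u • c a
    have hg0 : g = 0 := by
      have hsupp : ∀ b ∈ g.support, ∃ a ∈ u.support, b ∈ (c a).support := by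
        intro b hb
        by_contra! hcon
        refine Finsupp.mem_support_iff.1 hb ?_
        simp only [g, Finsupp.coe_finsetSum, Finset.sum_apply, Finsupp.smul_apply]
        exact Finset.sum_eq_zero fun a ha => by
          rw [Finsupp.notMem_support_iff.1 (hcon a ha), smul_zero]
      refine eq_zero_of_sum_smul_mon_eq_zero (l := stdMk L) (d := d) g (fun b hb => ?_)
        (fun b hb => ?_) ?_
      · obtain ⟨a, ha, hb⟩ := hsupp b hb
        obtain ⟨-, rfl | h⟩ := hc2 a b hb
        exacts [hdeg u hu b ha, h.1.trans (hdeg u hu a ha)]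
      · obtain ⟨a, ha, hb⟩ := hsupp b hb
        exact (hc2 a b hb).1
      · change Finsupp.linearCombination K (mon (stdMk L)) g = 0
        rw [← hmk]
        conv_rhs => rw [has_sum u]
        simp only [g, map_sum, map_smul, ← mon_stdMk]
        exact Finset.sum_congr rfl fun a _ => by
          rw [Finsupp.linearCombination_apply, hc1]
    have : NF u = Finsupp.linearCombination K (fun b => monomial b (1 : K)) g := by
      conv_lhs => rw [has_sum u]
      simp only [g, map_sum, map_smul, hNF, Finsupp.linearCombination_apply]
    rw [this, hg0, map_zero]
  have ht : ∀ t ≠ 0, ∀ u ∈ U,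
      ((Ideal.Quotient.mkₐ K L).comp (linHom (torusMat n d t⁻¹))).toLinearMap u = 0 →
        N t u = 0 := by
    intro t ht u hu hmk
    have h1 : N t u = linHom (torusMat n d t) (NF (linHom (torusMat n d t⁻¹) u)) := by
      rw [has_sum u]
      simp only [map_sum, map_smul]
      refine Finset.sum_congr rfl fun a ha => ?_
      rw [hN, linHom_torusMat, map_smul, hNF, map_smul]
      congr 1
      simp only [ν, Finsupp.sum, map_sum, map_smul, linHom_torusMat, Finset.smul_sum, smul_smul]
      refine Finset.sum_congr rfl fun b hb => ?_
      -- The subtraction of weights in `ν` is not truncated, because normal forms only involve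
      -- monomials of weight at least that of `a`.
      have hle : revWeight d a ≤ revWeight d b := by
        obtain ⟨-, rfl | h⟩ := hc2 a b hb
        exacts [le_rfl, (h.revWeight_lt (hdeg u (hUd u hu) a ha)).le]
      congr 1
      rw [pow_sub₀ t ht hle, inv_pow]
      ring
    rw [h1, hL0 _ (isHomogeneous_linHom _ (hUd u hu)) hmk, map_zero]
  have hpoly : ∀ b, (fun x : Unit → K => N (x ()) (mon (lin B) b)) ∈
      polyMaps Unit K (MvPolynomial (Fin n) K) := by
    intro b
    have h1 : (fun x : Unit → K => N (x ()) (mon (lin B) b)) =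
        ∑ a ∈ (mon (lin B) b).support, ∑ e ∈ (c a).support, fun x : Unit → K =>
          eval x (C (coeff a (mon (lin B) b) * c a e) * X () ^ (revWeight d e - revWeight d a)) •
            monomial e (1 : K) := by
      funext x
      conv_lhs => rw [has_sum (mon (lin B) b)]
      simp only [map_sum, map_smul, hN, ν, Finsupp.sum, Finset.smul_sum, smul_smul,
        Finset.sum_apply, map_mul, map_pow, eval_C, eval_X, mul_assoc]
    rw [h1]
    exact Submodule.sum_mem _ fun a _ => Submodule.sum_mem _ fun e _ => smul_mem_polyMaps _ _
  -- The parameter space is the affine line; a generic nonzero `t` is compared with `t = 0`.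
  obtain ⟨x, hx, hx0⟩ := ((eventually_finrank_span_le s hpoly (fun _ => 0)).and
    (eventually_eval_ne_zero (X_ne_zero () : (X () : MvPolynomial Unit K) ≠ 0))).exists
  rw [eval_X] at hx0
  have himg : ∀ t, Submodule.span K ((fun a => N t (mon (lin B) a)) '' (s : Set (Fin n →₀ ℕ))) =
      U.map (N t) := by
    intro t
    rw [hU, Submodule.map_span, ← Set.image_comp]
    rfl
  rw [himg, himg] at hx
  calc _ = Module.finrank K (U.map (Ideal.Quotient.mkₐ K G).toLinearMap) := by
        rw [span_mon_linMk]
    _ ≤ Module.finrank K (U.map (N 0)) := finrank_map_le_finrank_map _ _ U h0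
    _ ≤ Module.finrank K (U.map (N (x ()))) := hx
    _ ≤ Module.finrank K (U.map
          ((Ideal.Quotient.mkₐ K L).comp (linHom (torusMat n d (x ())⁻¹))).toLinearMap) :=
        finrank_map_le_finrank_map _ _ U (ht _ hx0)
    _ = Module.finrank K (Submodule.span K (mon
          (linMk L fun p => (torusMat n d (x ())⁻¹ * toMat B) p.1 p.2) '' (s : Set _))) := by
        have he : ((Ideal.Quotient.mkₐ K L).comp (linHom (torusMat n d (x ())⁻¹))).toLinearMap ∘
            mon (lin B) = mon (linMk L fun p => (torusMat n d (x ())⁻¹ * toMat B) p.1 p.2) := by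
          funext b
          simp only [Function.comp_apply, AlgHom.toLinearMap_apply, map_mon, AlgHom.comp_apply,
            linHom_lin]
          rfl
        rw [hU, Submodule.map_span, ← Set.image_comp, he]
    _ ≤ _ := finrank_span_le_card_not_genDep L hs _

/-- Passing to the generic initial ideal does not change generic dependence. -/
theorem genDep_gin_iff [Infinite K] {L : Ideal (MvPolynomial (Fin n) K)}
    (hL : L.IsHomogeneous (homogeneousSubmodule (Fin n) K)) (a : Fin n →₀ ℕ) :
    GenDep (gin L) a ↔ GenDep L a := by
  classical
  refine iff_of_card_filter_not_eq (fun s hs => ?_) a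
  have hup : IsUpperSet {a | GenDep L a} := fun _ _ hab ha => GenDep.mono ha hab
  apply le_antisymm
  -- Realise `gin L` as the initial ideal of a translate of `L`, which has the same generic
  -- dependence, and apply the degeneration bound.
  · obtain ⟨B, hB, hdet⟩ := (((tendsto_genericPts_inv (K := K) n).eventually
      (eventually_forall_dep_iff_genDep L)).and (eventually_det_ne_zero n)).exists
    have hu : IsUnit (toMat B).det := hdet.isUnit
    have hD : {a | Dep K (stdMk (L.map (linHom (toMat B)))) a} = {a | GenDep L a} := by
      ext a
      rw [Set.mem_ofPred_eq, dep_stdMk_map_linHom hu]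
      exact hB a
    have hgen : ∀ a, GenDep (L.map (linHom (toMat B))) a ↔ GenDep L a := by
      intro a
      obtain ⟨B', h1, h2⟩ := (((tendsto_genericPts_mul (toMat B) hu).eventually
        (eventually_dep_iff_genDep (L.map (linHom (toMat B))) a)).and
        (eventually_dep_iff_genDep L a)).exists
      rw [← h1, ← h2, dep_linMk_map_linHom hu]
    have h := card_not_genDep_monIdeal_le (L.map (linHom (toMat B))) hs
    rw [hD, ← gin_eq hL] at h
    rwa [Finset.filter_congr fun a _ => not_congr (hgen a)] at h
  -- Conversely, the identity matrix is a special point where the rank modulo `gin L` counts the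
  -- monomials outside `gin L`.
  · have h := finrank_span_le_card_not_genDep (gin L) hs
      fun p => (1 : Matrix (Fin n) (Fin n) K) p.1 p.2
    rw [← card_filter_not_dep _ hs] at h
    have h1 : (linMk (gin L) fun p => (1 : Matrix (Fin n) (Fin n) K) p.1 p.2) = stdMk (gin L) := by
      funext j
      rw [linMk, lin_one, stdMk]
    have h2 : ∀ a, Dep K (stdMk (gin L)) a ↔ GenDep L a := by
      intro a
      rw [gin_eq hL]
      exact dep_stdMk_monIdeal hup a
    rwa [h1, Finset.filter_congr fun a _ => not_congr (h2 a)] at h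

end Degeneration

/-! ### Dependence in a product of algebras -/

section Product

variable {K : Type*} [Field K] {n : ℕ}

/-- Sets of monomials in which every member has a divisor of degree one less all of whose
multiples by a variable belong to the set. -/
def IsExchangeable (s : Set (Fin n →₀ ℕ)) : Prop :=
  ∀ b ∈ s, ∃ r j, b = r + Finsupp.single j 1 ∧ ∀ i, r + Finsupp.single i 1 ∈ s

theorem isExchangeable_or_exists (a : Fin n →₀ ℕ) :
    IsExchangeable {b | RevLt b a} ∨
      ∃ r k, a = r + Finsupp.single k 1 ∧ ∀ q, q ≤ k → r q = 0 := by
  by_contra! hc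
  obtain ⟨h1, h2⟩ := hc
  refine h1 fun b hb => ?_
  rcases RevLt.exists_lowering hb with h | ⟨r, j, p, hjp, -, rfl, hr⟩
  · exact h
  · obtain ⟨q, hq, hrq⟩ := h2 r j rfl
    exact absurd (hr q (hq.trans_lt hjp)) hrq

/-- Among the multiples of a monomial by one variable, the one by the first variable is largest.
Including the top monomial therefore repairs the exceptional case of `RevLt.exists_lowering`. -/
theorem isExchangeable_leFinset (r : Fin n →₀ ℕ) {z : Fin n} (hz : ∀ i, z ≤ i) :
    IsExchangeable (leFinset (r + Finsupp.single z 1) : Set (Fin n →₀ ℕ)) := by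
  have key : ∀ r' : Fin n →₀ ℕ, ∀ i, r' + Finsupp.single i 1 ∈
      (leFinset (r' + Finsupp.single z 1) : Set (Fin n →₀ ℕ)) := by
    intro r' i
    rw [Finset.mem_coe, mem_leFinset]
    rcases (hz i).eq_or_lt with rfl | h
    exacts [Or.inl rfl, Or.inr (revLt_add_single h r')]
  intro b hb
  rw [Finset.mem_coe, mem_leFinset] at hb
  rcases hb with rfl | hb
  · exact ⟨r, z, rfl, key r⟩
  · rcases hb.exists_lowering with ⟨s, j, hs, h⟩ | ⟨r', j, p, hjp, rfl, ha, hr⟩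
    · exact ⟨s, j, hs, fun i => by rw [Finset.mem_coe, mem_leFinset]; exact Or.inr (h i)⟩
    · have hjz : j = z := by
        by_contra hne
        have := DFunLike.congr_fun ha z
        rw [Finsupp.add_apply, Finsupp.add_apply, hr z ((hz j).trans_lt hjp),
          Finsupp.single_eq_same, Finsupp.single_apply, if_neg hne] at this
        omega
      subst hjz
      rw [ha]
      exact ⟨r', p, rfl, key r'⟩

/-- Let `p` be the last index where `b` differs from `r * x_z`. If `k < p`, then `b` lies below `r *
x_k`; otherwise `r * x_p` divides `b`, and they agree by degree. -/
theorem exists_lt_of_revLt_of_le {r b : Fin n →₀ ℕ} {k z : Fin n} (hz : ∀ i, z ≤ i)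
    (hr : ∀ q, q ≤ k → r q = 0) (h : RevLt (r + Finsupp.single k 1) b)
    (hb : b ∈ leFinset (r + Finsupp.single z 1)) :
    ∃ j, j < k ∧ b = r + Finsupp.single j 1 := by
  rw [mem_leFinset] at hb
  rcases hb with rfl | hb
  · refine ⟨z, lt_of_le_of_ne (hz k) ?_, rfl⟩
    rintro rfl
    exact not_revLt_self _ h
  obtain ⟨hd, p, hp, hlt⟩ := hb
  have hzq : ∀ q, p < q → (Finsupp.single z 1 : Fin n →₀ ℕ) q = 0 := fun q hq => by
    rw [Finsupp.single_apply, if_neg ((hz p).trans_lt hq).ne]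
  rcases lt_or_ge k p with hkp | hpk
  · refine absurd (h.trans (revLt_of_le_of_lt (p := p) (by simp [hd]) ?_ fun q hq => ?_))
      (not_revLt_self _)
    · rw [Finsupp.add_apply, Finsupp.single_apply, if_neg hkp.ne]
      rw [Finsupp.add_apply] at hlt
      omega
    · rw [hp q hq, Finsupp.add_apply, Finsupp.add_apply, Finsupp.single_apply,
        if_neg (hkp.trans hq).ne, hzq q hq]
  · have hbp : r + Finsupp.single p 1 = b := by
      refine eq_of_le_of_degree_eq (fun q => ?_) (by simp [hd])
      rw [Finsupp.add_apply]
      rcases lt_trichotomy q p with hq | rfl | hq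
      · simp [hr q (hq.le.trans hpk), hq.ne']
      · rw [Finsupp.add_apply] at hlt
        rw [Finsupp.single_eq_same]
        omega
      · rw [hp q hq, Finsupp.add_apply, hzq q hq]
        simp [hq.ne]
    refine ⟨p, lt_of_le_of_ne hpk ?_, hbp.symm⟩
    rintro rfl
    rw [hbp] at h
    exact not_revLt_self _ h

variable {R R' : Type*} [CommRing R] [Algebra K R] [CommRing R'] [Algebra K R']

theorem finrank_prod_submodule {V W : Type*} [AddCommGroup V] [Module K V] [AddCommGroup W]
    [Module K W] (p : Submodule K V) (q : Submodule K W) [FiniteDimensional K p]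
    [FiniteDimensional K q] :
    Module.finrank K (p.prod q) = Module.finrank K p + Module.finrank K q := by
  have hinj : Function.Injective (p.subtype.prodMap q.subtype) :=
    Prod.map_injective.2 ⟨p.injective_subtype, q.injective_subtype⟩
  have := LinearMap.finrank_range_of_inj hinj
  rw [LinearMap.range_prodMap, Submodule.range_subtype, Submodule.range_subtype,
    Module.finrank_prod] at this
  exact this

theorem mon_prod (l : Fin n → R) (l' : Fin n → R') (a : Fin n →₀ ℕ) :
    mon (fun j => (l j, l' j)) a = (mon l a, mon l' a) :=
  Prod.ext (by simp [mon, Prod.fst_prod]) (by simp [mon, Prod.snd_prod])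

/-- If `(l j, 0)` is a linear combination of the pairs `(l i, l' i)`, then the span of an
exchangeable set of monomials in these pairs is a product. -/
theorem span_mon_prod {l : Fin n → R} {l' : Fin n → R'}
    (hl : ∀ j, (l j, (0 : R')) ∈ Submodule.span K (Set.range fun i => (l i, l' i)))
    {s : Set (Fin n →₀ ℕ)} (hs : IsExchangeable s) :
    Submodule.span K (mon (fun j => (l j, l' j)) '' s) =
      (Submodule.span K (mon l '' s)).prod (Submodule.span K (mon l' '' s)) := by
  have hl' : ∀ j, ((0 : R), l' j) ∈ Submodule.span K (Set.range fun i => (l i, l' i)) := by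
    intro j
    have : ((0 : R), l' j) = (l j, l' j) - (l j, 0) := by simp
    rw [this]
    exact Submodule.sub_mem _ (Submodule.subset_span ⟨j, rfl⟩) (hl j)
  -- Multiplying by `(l j, 0)` kills the second coordinate, and exchangeability keeps the product
  -- inside the span.
  have key : ∀ (r : Fin n →₀ ℕ), (∀ i, r + Finsupp.single i 1 ∈ s) →
      ∀ x ∈ Submodule.span K (Set.range fun i => (l i, l' i)),
        mon (fun j => (l j, l' j)) r * x ∈ Submodule.span K (mon (fun j => (l j, l' j)) '' s) := by
    intro r hr x hx
    have := Submodule.mem_map_of_mem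
      (f := LinearMap.mulLeft K (mon (fun j => (l j, l' j)) r)) hx
    rw [Submodule.map_span, LinearMap.mulLeft_apply, ← Set.range_comp] at this
    refine Submodule.span_mono ?_ this
    rintro _ ⟨i, rfl⟩
    refine ⟨_, hr i, ?_⟩
    rw [mon_add, mon_single]
    rfl
  apply le_antisymm
  · rw [Submodule.span_le]
    rintro _ ⟨b, hb, rfl⟩
    rw [mon_prod]
    exact ⟨Submodule.subset_span ⟨b, hb, rfl⟩, Submodule.subset_span ⟨b, hb, rfl⟩⟩
  · rw [Submodule.prod_le_iff, Submodule.map_span_le, Submodule.map_span_le]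
    constructor
    · rintro _ ⟨b, hb, rfl⟩
      obtain ⟨r, j, rfl, hr⟩ := hs b hb
      have := key r hr _ (hl j)
      rw [mon_prod, Prod.mk_mul_mk, mul_zero] at this
      rwa [LinearMap.inl_apply, mon_add, mon_single]
    · rintro _ ⟨b, hb, rfl⟩
      obtain ⟨r, j, rfl, hr⟩ := hs b hb
      have := key r hr _ (hl' j)
      rw [mon_prod, Prod.mk_mul_mk, mul_zero] at this
      rwa [LinearMap.inr_apply, mon_add, mon_single]

theorem dep_prod_iff {l : Fin n → R} {l' : Fin n → R'}
    (hl : ∀ j, (l j, (0 : R')) ∈ Submodule.span K (Set.range fun i => (l i, l' i)))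
    {a : Fin n →₀ ℕ} (ha : IsExchangeable {b | RevLt b a}) :
    Dep K (fun j => (l j, l' j)) a ↔ Dep K l a ∧ Dep K l' a := by
  rw [Dep, span_mon_prod hl ha, mon_prod, Submodule.mem_prod]
  rfl

open Classical in
theorem card_not_dep_prod {l : Fin n → R} {l' : Fin n → R'}
    (hl : ∀ j, (l j, (0 : R')) ∈ Submodule.span K (Set.range fun i => (l i, l' i)))
    {s : Finset (Fin n →₀ ℕ)} (hs : IsInitialSeg s)
    (hs' : IsExchangeable (s : Set (Fin n →₀ ℕ))) :
    (s.filter fun a => ¬ Dep K (fun j => (l j, l' j)) a).card =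
      (s.filter fun a => ¬ Dep K l a).card + (s.filter fun a => ¬ Dep K l' a).card := by
  have := FiniteDimensional.span_of_finite K (s.finite_toSet.image (mon l))
  have := FiniteDimensional.span_of_finite K (s.finite_toSet.image (mon l'))
  rw [card_filter_not_dep _ hs, card_filter_not_dep _ hs, card_filter_not_dep _ hs,
    span_mon_prod hl hs', finrank_prod_submodule]

end Product

/-! ### Families spanned by their last members -/

section Tail

variable {K : Type*} [Field K] {R : Type*} [CommRing R] [Algebra K R] {n k : ℕ}

theorem exists_eq_add_single {b : Fin n →₀ ℕ} {j : Fin n} (h : b j ≠ 0) :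
    ∃ r, b = r + Finsupp.single j 1 :=
  ⟨b - Finsupp.single j 1,
    (tsub_add_cancel_of_le (Finsupp.single_le_iff.2 (Nat.one_le_iff_ne_zero.2 h))).symm⟩

theorem revLt_mapDomain_iff {σ : Fin k → Fin n} (hσ : StrictMono σ)
    {a b : Fin k →₀ ℕ} : RevLt (b.mapDomain σ) (a.mapDomain σ) ↔ RevLt b a := by
  have himp : ∀ a b : Fin k →₀ ℕ, RevLt b a → RevLt (b.mapDomain σ) (a.mapDomain σ) := by
    rintro a b ⟨hd, i, hi, hlt⟩
    refine ⟨by simpa [Finsupp.degree_mapDomain] using hd, σ i, fun j hj => ?_, ?_⟩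
    · by_cases hjr : j ∈ Set.range σ
      · obtain ⟨j, rfl⟩ := hjr
        rw [Finsupp.mapDomain_apply hσ.injective, Finsupp.mapDomain_apply hσ.injective,
          hi j (hσ.lt_iff_lt.1 hj)]
      · rw [Finsupp.mapDomain_of_notMem_range _ _ hjr, Finsupp.mapDomain_of_notMem_range _ _ hjr]
    · rwa [Finsupp.mapDomain_apply hσ.injective, Finsupp.mapDomain_apply hσ.injective]
  refine ⟨fun h => ?_, himp a b⟩
  have hd : b.degree = a.degree := by simpa [Finsupp.degree_mapDomain] using h.1
  rcases revLt_trichotomy hd with h1 | rfl | h1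
  · exact h1
  · exact absurd h (not_revLt_self _)
  · exact absurd (h.trans (himp _ _ h1)) (not_revLt_self _)

theorem exists_mapDomain_eq {σ : Fin k → Fin n} (hσ : Function.Injective σ) {b : Fin n →₀ ℕ}
    (hb : ∀ j, b j ≠ 0 → j ∈ Set.range σ) : ∃ b' : Fin k →₀ ℕ, b = b'.mapDomain σ :=
  ⟨b.comapDomain σ hσ.injOn, (Finsupp.mapDomain_comapDomain σ hσ b
    fun j hj => hb j (Finsupp.mem_support_iff.1 hj)).symm⟩

/-- A form before the tail is a combination of tail forms, whose variables are all smaller; multiply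
this relation by the rest of the monomial. -/
theorem dep_of_notMem_range {l : Fin n → R} {σ : Fin k → Fin n}
    (hr : ∀ i j, σ i ≤ j → j ∈ Set.range σ)
    (hl : ∀ j, l j ∈ Submodule.span K (Set.range (l ∘ σ))) {b : Fin n →₀ ℕ} {j : Fin n}
    (hb : b j ≠ 0) (hj : j ∉ Set.range σ) :
    Dep K l b := by
  obtain ⟨r, rfl⟩ := exists_eq_add_single hb
  have := Submodule.mem_map_of_mem (f := LinearMap.mulLeft K (mon l r)) (hl j)
  rw [Submodule.map_span, LinearMap.mulLeft_apply, ← Set.range_comp] at this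
  rw [Dep, mon_add, mon_single]
  refine Submodule.span_mono ?_ this
  rintro _ ⟨i, rfl⟩
  have hji : j < σ i := by
    by_contra h
    exact hj (hr i j (not_lt.1 h))
  exact ⟨_, revLt_add_single hji r, by simp [mon_add, mon_single]⟩

theorem dep_iff_of_tail {l : Fin n → R} {σ : Fin k → Fin n} (hσ : StrictMono σ)
    (hr : ∀ i j, σ i ≤ j → j ∈ Set.range σ)
    (hl : ∀ j, l j ∈ Submodule.span K (Set.range (l ∘ σ))) (a : Fin n →₀ ℕ) :
    Dep K l a ↔ ∀ a' : Fin k →₀ ℕ, a = a'.mapDomain σ → Dep K (l ∘ σ) a' := by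
  have key : ∀ b, mon l b ∈ Submodule.span K (mon l ''
      {c | (c = b ∨ RevLt c b) ∧ ∃ c' : Fin k →₀ ℕ, c = c'.mapDomain σ}) := by
    intro b
    induction b using wellFounded_revLt.induction with
    | _ b ih =>
      by_cases hb : ∀ j, b j ≠ 0 → j ∈ Set.range σ
      · exact Submodule.subset_span ⟨b, ⟨Or.inl rfl, exists_mapDomain_eq hσ.injective hb⟩, rfl⟩
      · push Not at hb
        obtain ⟨j, hbj, hj⟩ := hb
        refine Submodule.span_le.2 ?_ (dep_of_notMem_range hr hl hbj hj)
        rintro _ ⟨c, hc, rfl⟩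
        refine Submodule.span_mono (Set.image_mono ?_) (ih c hc)
        rintro e ⟨rfl | hec, he⟩
        exacts [⟨Or.inr hc, he⟩, ⟨Or.inr (hec.trans hc), he⟩]
  by_cases ha : ∀ j, a j ≠ 0 → j ∈ Set.range σ
  · obtain ⟨a', rfl⟩ := exists_mapDomain_eq hσ.injective ha
    have hinj := Finsupp.mapDomain_injective (M := ℕ) hσ.injective
    have hspan : Submodule.span K (mon l '' {b | RevLt b (a'.mapDomain σ)}) =
        Submodule.span K (mon (l ∘ σ) '' {b | RevLt b a'}) := by
      apply le_antisymm
      · rw [Submodule.span_le]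
        rintro _ ⟨b, hb, rfl⟩
        refine Submodule.span_mono ?_ (key b)
        rintro _ ⟨_, ⟨hcb, c, rfl⟩, rfl⟩
        refine ⟨c, (revLt_mapDomain_iff hσ).1 ?_, mon_comp _ hσ.injective c⟩
        rcases hcb with rfl | hcb
        exacts [hb, hcb.trans hb]
      · refine Submodule.span_mono ?_
        rintro _ ⟨b, hb, rfl⟩
        exact ⟨_, (revLt_mapDomain_iff hσ).2 hb, (mon_comp _ hσ.injective b).symm⟩
    rw [Dep, hspan, ← mon_comp _ hσ.injective]
    constructor
    · rintro h a'' heq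
      rwa [← hinj heq]
    · exact fun h => h a' rfl
  · refine iff_of_true ?_ ?_
    · push Not at ha
      obtain ⟨j, haj, hj⟩ := ha
      exact dep_of_notMem_range hr hl haj hj
    · rintro a' rfl
      refine absurd (fun j hj => ?_) ha
      by_contra hjr
      exact hj (Finsupp.mapDomain_of_notMem_range _ _ hjr)

end Tail

/-! ### Membership in the fibre product ideal -/

section Fibre

variable {K : Type*} [Field K] {n m : ℕ}

/-- Setting the last `m` variables to zero. -/
noncomputable def projLeft (K : Type*) [Field K] (n m : ℕ) :
    MvPolynomial (Fin (n + m)) K →ₐ[K] MvPolynomial (Fin n) K :=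
  aeval (Fin.addCases X fun _ => 0)

/-- Setting the first `n` variables to zero. -/
noncomputable def projRight (K : Type*) [Field K] (n m : ℕ) :
    MvPolynomial (Fin (n + m)) K →ₐ[K] MvPolynomial (Fin m) K :=
  aeval (Fin.addCases (fun _ => 0) X)

@[simp] theorem projLeft_X_castAdd (i : Fin n) :
    projLeft K n m (X (Fin.castAdd m i)) = X i := by simp [projLeft]

@[simp] theorem projLeft_X_natAdd (j : Fin m) :
    projLeft K n m (X (Fin.natAdd n j)) = 0 := by simp [projLeft]

@[simp] theorem projRight_X_castAdd (i : Fin n) :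
    projRight K n m (X (Fin.castAdd m i)) = 0 := by simp [projRight]

@[simp] theorem projRight_X_natAdd (j : Fin m) :
    projRight K n m (X (Fin.natAdd n j)) = X j := by simp [projRight]

theorem projLeft_rename_castAdd (f : MvPolynomial (Fin n) K) :
    projLeft K n m (rename (Fin.castAdd m) f) = f := by
  have : (projLeft K n m).comp (rename (Fin.castAdd m)) = AlgHom.id K _ := by
    ext1 i; simp
  exact AlgHom.congr_fun this f

theorem projRight_rename_natAdd (f : MvPolynomial (Fin m) K) :
    projRight K n m (rename (Fin.natAdd n) f) = f := by
  have : (projRight K n m).comp (rename (Fin.natAdd n)) = AlgHom.id K _ := by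
    ext1 i; simp
  exact AlgHom.congr_fun this f

theorem projLeft_rename_natAdd (f : MvPolynomial (Fin m) K) :
    projLeft K n m (rename (Fin.natAdd n) f) = C (constantCoeff f) := by
  induction f using MvPolynomial.induction_on with
  | C a => simp
  | add p q hp hq => simp [hp, hq]
  | mul_X p i _ => simp

theorem projRight_rename_castAdd (f : MvPolynomial (Fin n) K) :
    projRight K n m (rename (Fin.castAdd m) f) = C (constantCoeff f) := by
  induction f using MvPolynomial.induction_on with
  | C a => simp
  | add p q hp hq => simp [hp, hq]
  | mul_X p i _ => simp

theorem constantCoeff_projLeft (f : MvPolynomial (Fin (n + m)) K) :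
    constantCoeff (projLeft K n m f) = constantCoeff f := by
  induction f using MvPolynomial.induction_on with
  | C a => simp
  | add p q hp hq => simp [hp, hq]
  | mul_X p i _ => induction i using Fin.addCases <;> simp

theorem constantCoeff_projRight (f : MvPolynomial (Fin (n + m)) K) :
    constantCoeff (projRight K n m f) = constantCoeff f := by
  induction f using MvPolynomial.induction_on with
  | C a => simp
  | add p q hp hq => simp [hp, hq]
  | mul_X p i _ => induction i using Fin.addCases <;> simp

theorem constantCoeff_eq_zero_of_mem {L : Ideal (MvPolynomial (Fin n) K)}
    (hL : L.IsHomogeneous (homogeneousSubmodule (Fin n) K)) (hL' : L ≠ ⊤)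
    {f : MvPolynomial (Fin n) K} (hf : f ∈ L) : constantCoeff f = 0 := by
  by_contra hne
  have h := homogeneousComponent_mem_of_mem hL hf 0
  rw [homogeneousComponent_zero] at h
  exact hL' (L.eq_top_of_isUnit_mem h ((Ne.isUnit hne).map C))

theorem rename_sub_C_mem {k : ℕ} (e : Fin k → Fin n) (f : MvPolynomial (Fin k) K) :
    rename e f - C (constantCoeff f) ∈
      Ideal.span (Set.range fun i => (X (e i) : MvPolynomial (Fin n) K)) := by
  induction f using MvPolynomial.induction_on with
  | C a => simp
  | add p q hp hq =>
    have := Ideal.add_mem _ hp hq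
    convert this using 1
    simp only [map_add]
    ring
  | mul_X p i _ =>
    rw [map_mul, map_mul, constantCoeff_X, mul_zero, map_zero, sub_zero, rename_X]
    exact Ideal.mul_mem_left _ _ (Ideal.subset_span ⟨i, rfl⟩)

/-- Removing the pure `x` and pure `y` parts leaves mixed terms only; the constant, subtracted
twice, is added back once. -/
theorem sub_mem_span_mul_span (f : MvPolynomial (Fin (n + m)) K) :
    f - rename (Fin.castAdd m) (projLeft K n m f) - rename (Fin.natAdd n) (projRight K n m f) +
        C (constantCoeff f) ∈
      Ideal.span (Set.range fun i : Fin n => (X (Fin.castAdd m i) : MvPolynomial (Fin (n + m)) K)) *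
        Ideal.span (Set.range fun j : Fin m => X (Fin.natAdd n j)) := by
  induction f using MvPolynomial.induction_on with
  | C a => simp
  | add p q hp hq =>
    have := Ideal.add_mem _ hp hq
    convert this using 1
    simp only [map_add]
    ring
  | mul_X p i hp =>
    induction i using Fin.addCases with
    | left i =>
      have h1 := Ideal.mul_mem_mul (Ideal.subset_span (Set.mem_range_self i) :
          (X (Fin.castAdd m i) : MvPolynomial (Fin (n + m)) K) ∈ Ideal.span (Set.range fun i : Fin n =>
            (X (Fin.castAdd m i) : MvPolynomial (Fin (n + m)) K)))
        (rename_sub_C_mem (K := K) (Fin.natAdd n) (projRight K n m p))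
      rw [constantCoeff_projRight] at h1
      have h2 := Ideal.mul_mem_right (X (Fin.castAdd m i)) _ hp
      convert Ideal.add_mem _ h1 h2 using 1
      simp only [map_mul, projLeft_X_castAdd, projRight_X_castAdd, rename_X, mul_zero, map_zero,
        constantCoeff_X]
      ring
    | right j =>
      have h1 := Ideal.mul_mem_mul (rename_sub_C_mem (K := K) (Fin.castAdd m) (projLeft K n m p))
        (Ideal.subset_span (Set.mem_range_self j) :
          (X (Fin.natAdd n j) : MvPolynomial (Fin (n + m)) K) ∈ Ideal.span (Set.range fun j : Fin m =>
            (X (Fin.natAdd n j) : MvPolynomial (Fin (n + m)) K)))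
      rw [constantCoeff_projLeft] at h1
      have h2 := Ideal.mul_mem_right (X (Fin.natAdd n j)) _ hp
      convert Ideal.add_mem _ h1 h2 using 1
      simp only [map_mul, projLeft_X_natAdd, projRight_X_natAdd, rename_X, mul_zero, map_zero,
        constantCoeff_X]
      ring

theorem fibreIdeal_le_comap_projLeft (I : Ideal (MvPolynomial (Fin n) K))
    {J : Ideal (MvPolynomial (Fin m) K)}
    (hJ : J.IsHomogeneous (homogeneousSubmodule (Fin m) K)) (hJ' : J ≠ ⊤) :
    fibreIdeal I J ≤ I.comap (projLeft K n m) := by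
  rw [fibreIdeal, sup_le_iff, sup_le_iff, Ideal.map_le_iff_le_comap, Ideal.map_le_iff_le_comap]
  refine ⟨⟨fun f hf => ?_, fun f hf => ?_⟩, Ideal.mul_le_right.trans ?_⟩
  · rw [Ideal.mem_comap, Ideal.mem_comap, projLeft_rename_castAdd]
    exact hf
  · rw [Ideal.mem_comap, Ideal.mem_comap, projLeft_rename_natAdd,
      constantCoeff_eq_zero_of_mem hJ hJ' hf, map_zero]
    exact I.zero_mem
  · rw [Ideal.span_le]
    rintro _ ⟨j, rfl⟩
    simp

theorem fibreIdeal_le_comap_projRight {I : Ideal (MvPolynomial (Fin n) K)}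
    (hI : I.IsHomogeneous (homogeneousSubmodule (Fin n) K)) (hI' : I ≠ ⊤)
    (J : Ideal (MvPolynomial (Fin m) K)) :
    fibreIdeal I J ≤ J.comap (projRight K n m) := by
  rw [fibreIdeal, sup_le_iff, sup_le_iff, Ideal.map_le_iff_le_comap, Ideal.map_le_iff_le_comap]
  refine ⟨⟨fun f hf => ?_, fun f hf => ?_⟩, Ideal.mul_le_left.trans ?_⟩
  · rw [Ideal.mem_comap, Ideal.mem_comap, projRight_rename_castAdd,
      constantCoeff_eq_zero_of_mem hI hI' hf, map_zero]
    exact J.zero_mem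
  · rw [Ideal.mem_comap, Ideal.mem_comap, projRight_rename_natAdd]
    exact hf
  · rw [Ideal.span_le]
    rintro _ ⟨j, rfl⟩
    simp

theorem mem_fibreIdeal_iff {I : Ideal (MvPolynomial (Fin n) K)}
    {J : Ideal (MvPolynomial (Fin m) K)}
    (hI : I.IsHomogeneous (homogeneousSubmodule (Fin n) K)) (hI' : I ≠ ⊤)
    (hJ : J.IsHomogeneous (homogeneousSubmodule (Fin m) K)) (hJ' : J ≠ ⊤)
    {f : MvPolynomial (Fin (n + m)) K} (hf : constantCoeff f = 0) :
    f ∈ fibreIdeal I J ↔ projLeft K n m f ∈ I ∧ projRight K n m f ∈ J := by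
  refine ⟨fun h => ⟨fibreIdeal_le_comap_projLeft I hJ hJ' h,
    fibreIdeal_le_comap_projRight hI hI' J h⟩, fun ⟨h1, h2⟩ => ?_⟩
  have h3 := sub_mem_span_mul_span f
  rw [hf, map_zero, add_zero] at h3
  have h4 : f = rename (Fin.castAdd m) (projLeft K n m f) +
      rename (Fin.natAdd n) (projRight K n m f) +
      (f - rename (Fin.castAdd m) (projLeft K n m f) -
        rename (Fin.natAdd n) (projRight K n m f)) := by ring
  rw [h4, fibreIdeal]
  exact Submodule.add_mem_sup (Submodule.add_mem_sup (Ideal.mem_map_of_mem _ h1)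
    (Ideal.mem_map_of_mem _ h2)) h3

theorem fibreIdeal_isHomogeneous {I : Ideal (MvPolynomial (Fin n) K)}
    {J : Ideal (MvPolynomial (Fin m) K)}
    (hI : I.IsHomogeneous (homogeneousSubmodule (Fin n) K))
    (hJ : J.IsHomogeneous (homogeneousSubmodule (Fin m) K)) :
    (fibreIdeal I J).IsHomogeneous (homogeneousSubmodule (Fin (n + m)) K) := by
  have hmap : ∀ {k N : ℕ} {L : Ideal (MvPolynomial (Fin k) K)} (e : Fin k → Fin N),
      L.IsHomogeneous (homogeneousSubmodule (Fin k) K) →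
        (L.map (rename e : MvPolynomial (Fin k) K →ₐ[K] MvPolynomial (Fin N) K)).IsHomogeneous
          (homogeneousSubmodule (Fin N) K) := by
    intro k N L e hL
    obtain ⟨s, hs⟩ := (Ideal.IsHomogeneous.iff_exists _ _).1 hL
    rw [hs, Ideal.map_span]
    apply Ideal.homogeneous_span
    rintro _ ⟨_, ⟨⟨f, d, hf⟩, -, rfl⟩, rfl⟩
    exact ⟨d, IsHomogeneous.rename_isHomogeneous hf⟩
  have hvar : ∀ {k N : ℕ} (e : Fin k → Fin N), (Ideal.span (Set.range fun i =>
      (X (e i) : MvPolynomial (Fin N) K))).IsHomogeneous (homogeneousSubmodule (Fin N) K) := by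
    intro k N e
    apply Ideal.homogeneous_span
    rintro _ ⟨i, rfl⟩
    exact ⟨1, isHomogeneous_X K _⟩
  exact ((hmap _ hI).sup (hmap _ hJ)).sup ((hvar _).mul (hvar _))

theorem fibreIdeal_top_left (J : Ideal (MvPolynomial (Fin m) K)) :
    fibreIdeal (⊤ : Ideal (MvPolynomial (Fin n) K)) J = ⊤ := by
  simp [fibreIdeal, Ideal.map_top]

theorem fibreIdeal_top_right (I : Ideal (MvPolynomial (Fin n) K)) :
    fibreIdeal I (⊤ : Ideal (MvPolynomial (Fin m) K)) = ⊤ := by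
  simp [fibreIdeal, Ideal.map_top]

/-! ### Generic dependence for fibre products -/

/-- The images in `K[x]/I` of the linear forms given by the columns of a matrix. -/
noncomputable def linLeft (I : Ideal (MvPolynomial (Fin n) K))
    (B : Fin (n + m) × Fin (n + m) → K) (j : Fin (n + m)) : MvPolynomial (Fin n) K ⧸ I :=
  Ideal.Quotient.mkₐ K I (projLeft K n m (lin B j))

/-- The images in `K[y]/J` of the linear forms given by the columns of a matrix. -/
noncomputable def linRight (J : Ideal (MvPolynomial (Fin m) K))
    (B : Fin (n + m) × Fin (n + m) → K) (j : Fin (n + m)) : MvPolynomial (Fin m) K ⧸ J :=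
  Ideal.Quotient.mkₐ K J (projRight K n m (lin B j))

/-- All monomials concerned have positive degree, where the two projections detect membership in the
fibre ideal. -/
theorem dep_linMk_fibreIdeal {I : Ideal (MvPolynomial (Fin n) K)}
    {J : Ideal (MvPolynomial (Fin m) K)}
    (hI : I.IsHomogeneous (homogeneousSubmodule (Fin n) K)) (hI' : I ≠ ⊤)
    (hJ : J.IsHomogeneous (homogeneousSubmodule (Fin m) K)) (hJ' : J ≠ ⊤)
    (B : Fin (n + m) × Fin (n + m) → K) {a : Fin (n + m) →₀ ℕ} (ha : a ≠ 0) :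
    Dep K (linMk (fibreIdeal I J) B) a ↔ Dep K (fun j => (linLeft I B j, linRight J B j)) a := by
  have hmon : ∀ b : Fin (n + m) →₀ ℕ, b.degree = a.degree →
      mon (lin B) b ∈ homogeneousSubmodule (Fin (n + m)) K a.degree := by
    intro b hb
    have h := isHomogeneous_linHom (toMat B) (isHomogeneous_monomial (1 : K) hb)
    rw [← mon_X, map_mon] at h
    simp only [linHom_X] at h
    exact h
  have h := mem_span_image_congr (Ideal.Quotient.mkₐ K (fibreIdeal I J)).toLinearMap
    (((Ideal.Quotient.mkₐ K I).comp (projLeft K n m)).prod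
      ((Ideal.Quotient.mkₐ K J).comp (projRight K n m))).toLinearMap
    (homogeneousSubmodule (Fin (n + m)) K a.degree) (fun u hu => by
      have hu0 : constantCoeff u = 0 := by
        rw [constantCoeff_eq]
        refine (hu : u.IsHomogeneous _).coeff_eq_zero ?_
        rw [map_zero]
        exact fun h => ha ((Finsupp.degree_eq_zero_iff a).1 h.symm)
      change Ideal.Quotient.mk _ u = 0 ↔
        (Ideal.Quotient.mk I (projLeft K n m u), Ideal.Quotient.mk J (projRight K n m u)) = (0, 0)
      rw [Prod.mk.injEq, Ideal.Quotient.eq_zero_iff_mem, Ideal.Quotient.eq_zero_iff_mem,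
        Ideal.Quotient.eq_zero_iff_mem, mem_fibreIdeal_iff hI hI' hJ hJ' hu0])
    (mon (lin B)) (s := {b | RevLt b a}) (fun b hb => hmon b hb.1) (hmon a rfl)
  simp only [AlgHom.toLinearMap_apply, map_mon] at h
  exact h

theorem mem_span_range_lin {B : Fin n × Fin n → K} (hB : (toMat B).det ≠ 0)
    {f : MvPolynomial (Fin n) K} (hf : f.IsHomogeneous 1) :
    f ∈ Submodule.span K (Set.range (lin B)) := by
  have h : f ∈ homogeneousSubmodule (Fin n) K 1 := hf
  rw [← span_mon_lin_degFinset hB] at h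
  refine Submodule.span_mono ?_ h
  rintro _ ⟨a, ha, rfl⟩
  obtain ⟨j, rfl⟩ := exists_eq_single_of_degree_eq_one (mem_degFinset.1 ha)
  exact ⟨j, (mon_single _ j).symm⟩

theorem projLeft_lin (B : Fin (n + m) × Fin (n + m) → K) (j : Fin (n + m)) :
    projLeft K n m (lin B j) = ∑ i : Fin n, C (B (Fin.castAdd m i, j)) * X i := by
  simp [lin, Fin.sum_univ_add]

theorem projRight_lin (B : Fin (n + m) × Fin (n + m) → K) (j : Fin (n + m)) :
    projRight K n m (lin B j) = ∑ i : Fin m, C (B (Fin.natAdd n i, j)) * X i := by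
  simp [lin, Fin.sum_univ_add]

theorem isHomogeneous_sum_C_mul_X (c : Fin n → K) :
    (∑ i, C (c i) * X i : MvPolynomial (Fin n) K).IsHomogeneous 1 := by
  refine IsHomogeneous.sum _ _ _ fun i _ => ?_
  simpa using (isHomogeneous_C (Fin n) (c i)).mul (isHomogeneous_X K i)

/-- The `x`-part of a form is itself a linear form of the big ring, hence a combination of the
columns of `B`. This is the hypothesis of `span_mon_prod`. -/
theorem linLeft_mem_span (I : Ideal (MvPolynomial (Fin n) K)) (J : Ideal (MvPolynomial (Fin m) K))
    {B : Fin (n + m) × Fin (n + m) → K} (hB : (toMat B).det ≠ 0) (j : Fin (n + m)) :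
    (linLeft I B j, (0 : MvPolynomial (Fin m) K ⧸ J)) ∈
      Submodule.span K (Set.range fun i => (linLeft I B i, linRight J B i)) := by
  set f : MvPolynomial (Fin n) K := ∑ i : Fin n, C (B (Fin.castAdd m i, j)) * X i with hf
  have hf1 : f.IsHomogeneous 1 := isHomogeneous_sum_C_mul_X _
  have h := Submodule.mem_map_of_mem (f := (((Ideal.Quotient.mkₐ K I).comp (projLeft K n m)).prod
      ((Ideal.Quotient.mkₐ K J).comp (projRight K n m))).toLinearMap)
    (mem_span_range_lin hB (hf1.rename_isHomogeneous (f := Fin.castAdd m)))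
  rw [Submodule.map_span, ← Set.range_comp] at h
  have h1 : constantCoeff f = 0 := by simp [hf]
  have h2 : (((Ideal.Quotient.mkₐ K I).comp (projLeft K n m)).prod
      ((Ideal.Quotient.mkₐ K J).comp (projRight K n m))).toLinearMap (rename (Fin.castAdd m) f) =
      (linLeft I B j, 0) := by
    change (Ideal.Quotient.mkₐ K I (projLeft K n m (rename (Fin.castAdd m) f)),
      Ideal.Quotient.mkₐ K J (projRight K n m (rename (Fin.castAdd m) f))) = _
    rw [projLeft_rename_castAdd, projRight_rename_castAdd, h1, map_zero, map_zero, linLeft,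
      projLeft_lin]
  rw [h2] at h
  exact h

/-- The last `n` of the `n + m` indices. -/
def tailLeft (n m : ℕ) (i : Fin n) : Fin (n + m) := (Fin.natAdd m i).cast (Nat.add_comm m n)

theorem tailLeft_strictMono : StrictMono (tailLeft n m) := fun i j h => by
  simp only [tailLeft, Fin.lt_def, Fin.val_cast, Fin.val_natAdd] at *
  omega

theorem mem_range_tailLeft {i : Fin n} {j : Fin (n + m)} (h : tailLeft n m i ≤ j) :
    j ∈ Set.range (tailLeft n m) := by
  simp only [tailLeft, Fin.le_def, Fin.val_cast, Fin.val_natAdd] at h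
  refine ⟨⟨j - m, by omega⟩, Fin.ext ?_⟩
  simp only [tailLeft, Fin.val_cast, Fin.val_natAdd]
  omega

theorem natAdd_strictMono : StrictMono (Fin.natAdd (m := m) n) := fun i j h => by
  simp only [Fin.lt_def, Fin.val_natAdd] at *
  omega

theorem mem_range_natAdd {i : Fin m} {j : Fin (n + m)} (h : Fin.natAdd n i ≤ j) :
    j ∈ Set.range (Fin.natAdd (m := m) n) := by
  simp only [Fin.le_def, Fin.val_natAdd] at h
  exact ⟨⟨j - n, by omega⟩, Fin.ext (by simp only [Fin.val_natAdd]; omega)⟩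

/-- The last `n` columns, restricted to the `x`-rows, form an invertible block, so their `x`-parts
span all linear forms in `x` and `dep_iff_of_tail` applies. -/
theorem dep_linLeft_iff (I : Ideal (MvPolynomial (Fin n) K)) (B : Fin (n + m) × Fin (n + m) → K)
    {B' : Fin n × Fin n → K} (hB : B' = fun p => B (Fin.castAdd m p.1, tailLeft n m p.2))
    (hB' : (toMat B').det ≠ 0) (a : Fin (n + m) →₀ ℕ) :
    Dep K (linLeft I B) a ↔
      ∀ a' : Fin n →₀ ℕ, a = a'.mapDomain (tailLeft n m) → Dep K (linMk I B') a' := by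
  have h : linLeft I B ∘ tailLeft n m = linMk I B' := by
    funext i
    rw [Function.comp_apply, linLeft, projLeft_lin, linMk, lin, hB]
  rw [← h]
  refine dep_iff_of_tail tailLeft_strictMono (fun _ _ => mem_range_tailLeft) (fun j => ?_) a
  have h1 := Submodule.mem_map_of_mem (f := (Ideal.Quotient.mkₐ K I).toLinearMap)
    (mem_span_range_lin hB' (isHomogeneous_sum_C_mul_X fun i => B (Fin.castAdd m i, j)))
  rw [Submodule.map_span, ← Set.range_comp] at h1
  rw [h, linLeft, projLeft_lin]
  exact h1

theorem dep_linRight_iff (J : Ideal (MvPolynomial (Fin m) K)) (B : Fin (n + m) × Fin (n + m) → K)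
    {B' : Fin m × Fin m → K} (hB : B' = fun p => B (Fin.natAdd n p.1, Fin.natAdd n p.2))
    (hB' : (toMat B').det ≠ 0) (a : Fin (n + m) →₀ ℕ) :
    Dep K (linRight J B) a ↔
      ∀ a' : Fin m →₀ ℕ, a = a'.mapDomain (Fin.natAdd n) → Dep K (linMk J B') a' := by
  have h : linRight J B ∘ Fin.natAdd n = linMk J B' := by
    funext i
    rw [Function.comp_apply, linRight, projRight_lin, linMk, lin, hB]
  rw [← h]
  refine dep_iff_of_tail natAdd_strictMono (fun _ _ => mem_range_natAdd) (fun j => ?_) a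
  have h1 := Submodule.mem_map_of_mem (f := (Ideal.Quotient.mkₐ K J).toLinearMap)
    (mem_span_range_lin hB' (isHomogeneous_sum_C_mul_X fun i => B (Fin.natAdd n i, j)))
  rw [Submodule.map_span, ← Set.range_comp] at h1
  rw [h, linRight, projRight_lin]
  exact h1

open Filter in
open Classical in
/-- Generic dependence modulo the fibre product ideal is governed by generic dependence modulo the
two factors, on exchangeable sets of monomials. -/
theorem genDep_fibreIdeal [Infinite K] {I : Ideal (MvPolynomial (Fin n) K)}
    {J : Ideal (MvPolynomial (Fin m) K)}
    (hI : I.IsHomogeneous (homogeneousSubmodule (Fin n) K)) (hI' : I ≠ ⊤)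
    (hJ : J.IsHomogeneous (homogeneousSubmodule (Fin m) K)) (hJ' : J ≠ ⊤)
    {DI DJ : (Fin (n + m) →₀ ℕ) → Prop}
    (hDI : ∀ a, DI a ↔ ∀ a' : Fin n →₀ ℕ, a = a'.mapDomain (tailLeft n m) → GenDep I a')
    (hDJ : ∀ a, DJ a ↔ ∀ a' : Fin m →₀ ℕ, a = a'.mapDomain (Fin.natAdd n) → GenDep J a') :
    (¬ GenDep (fibreIdeal I J) 0) ∧
    (∀ a, a ≠ 0 → IsExchangeable {b | RevLt b a} →
      (GenDep (fibreIdeal I J) a ↔ DI a ∧ DJ a)) ∧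
    ∀ s : Finset (Fin (n + m) →₀ ℕ), IsInitialSeg s →
      IsExchangeable (s : Set (Fin (n + m) →₀ ℕ)) →
        (s.filter fun a => ¬ GenDep (fibreIdeal I J) a).card =
          (s.filter fun a => ¬ DI a).card + (s.filter fun a => ¬ DJ a).card := by
  have hinjL : Function.Injective (fun p : Fin n × Fin n =>
      (Fin.castAdd m p.1, tailLeft n m p.2)) := fun p q h => by
    simp only [Prod.mk.injEq, Fin.castAdd_inj, tailLeft_strictMono.injective.eq_iff] at h
    exact Prod.ext h.1 h.2
  have hinjR : Function.Injective (fun p : Fin m × Fin m =>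
      (Fin.natAdd n p.1, Fin.natAdd n p.2)) := fun p q h => by
    simp only [Prod.mk.injEq, Fin.natAdd_inj] at h
    exact Prod.ext h.1 h.2
  have hL := tendsto_genericPts_comp (K := K) hinjL
  have hR := tendsto_genericPts_comp (K := K) hinjR
  -- One matrix can be generic for the fibre ideal while its two blocks are generic for `I` and `J`.
  obtain ⟨B, hF, hdet, hIB, hdetI, hJB, hdetJ⟩ :=
    ((eventually_forall_dep_iff_genDep (fibreIdeal I J)).and
    ((eventually_det_ne_zero (n + m)).and
    ((hL.eventually (eventually_forall_dep_iff_genDep I)).and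
    ((hL.eventually (eventually_det_ne_zero n)).and
    ((hR.eventually (eventually_forall_dep_iff_genDep J)).and
    (hR.eventually (eventually_det_ne_zero m))))))).exists
  have hl : ∀ a, Dep K (linLeft I B) a ↔ DI a := fun a => by
    rw [dep_linLeft_iff I B rfl hdetI, hDI]
    exact forall_congr' fun a' => imp_congr_right fun _ => hIB a'
  have hr : ∀ a, Dep K (linRight J B) a ↔ DJ a := fun a => by
    rw [dep_linRight_iff J B rfl hdetJ, hDJ]
    exact forall_congr' fun a' => imp_congr_right fun _ => hJB a'
  have hspan := linLeft_mem_span I J hdet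
  refine ⟨fun h0 => ?_, fun a ha hs => ?_, fun s hs hs' => ?_⟩
  · have h1 : (1 : MvPolynomial (Fin (n + m)) K) ∈ fibreIdeal I J :=
      (Ideal.eq_top_iff_one _).1 (genDep_zero_iff.1 h0)
    have h2 := fibreIdeal_le_comap_projLeft I hJ hJ' h1
    rw [Ideal.mem_comap, map_one] at h2
    exact hI' ((Ideal.eq_top_iff_one I).2 h2)
  · rw [← hF, dep_linMk_fibreIdeal hI hI' hJ hJ' B ha, dep_prod_iff hspan hs, hl, hr]
  · have h := card_not_dep_prod hspan hs hs'
    rw [Finset.filter_congr fun a _ => not_congr (hl a),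
      Finset.filter_congr fun a _ => not_congr (hr a)] at h
    rw [← h]
    congr 1
    refine Finset.filter_congr fun a ha => ?_
    have ha0 : a ≠ 0 := by
      rintro rfl
      obtain ⟨r, j, hrj, -⟩ := hs' 0 ha
      have := DFunLike.congr_fun hrj j
      simp at this
    rw [← hF, dep_linMk_fibreIdeal hI hI' hJ hJ' B ha0]

/-- Generic dependence modulo a fibre product ideal is determined by generic dependence modulo the
two factors. -/
theorem genDep_fibreIdeal_congr [Infinite K] {I I₁ : Ideal (MvPolynomial (Fin n) K)}
    {J J₁ : Ideal (MvPolynomial (Fin m) K)}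
    (hI : I.IsHomogeneous (homogeneousSubmodule (Fin n) K)) (hI' : I ≠ ⊤)
    (hJ : J.IsHomogeneous (homogeneousSubmodule (Fin m) K)) (hJ' : J ≠ ⊤)
    (hI₁ : I₁.IsHomogeneous (homogeneousSubmodule (Fin n) K)) (hI₁' : I₁ ≠ ⊤)
    (hJ₁ : J₁.IsHomogeneous (homogeneousSubmodule (Fin m) K)) (hJ₁' : J₁ ≠ ⊤)
    (hII : ∀ a, GenDep I a ↔ GenDep I₁ a) (hJJ : ∀ a, GenDep J a ↔ GenDep J₁ a)
    (a : Fin (n + m) →₀ ℕ) : GenDep (fibreIdeal I J) a ↔ GenDep (fibreIdeal I₁ J₁) a := by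
  classical
  obtain ⟨h0, hlt, hcard⟩ := genDep_fibreIdeal hI hI' hJ hJ' (fun a => Iff.rfl) (fun a => Iff.rfl)
  -- The predicates are stated through `I` and `J` again, so both applications produce literally the
  -- same counts.
  obtain ⟨h0₁, hlt₁, hcard₁⟩ := genDep_fibreIdeal hI₁ hI₁' hJ₁ hJ₁'
    (DI := fun a => ∀ a' : Fin n →₀ ℕ, a = a'.mapDomain (tailLeft n m) → GenDep I a')
    (DJ := fun a => ∀ a' : Fin m →₀ ℕ, a = a'.mapDomain (Fin.natAdd n) → GenDep J a')
    (fun a => by simp only [hII]) (fun a => by simp only [hJJ])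
  induction a using wellFounded_revLt.induction with
  | _ a ih =>
    rcases eq_or_ne a 0 with rfl | ha
    · exact iff_of_false h0 h0₁
    rcases isExchangeable_or_exists a with hs | ⟨r, k, rfl, hr⟩
    · rw [hlt a ha hs, hlt₁ a ha hs]
    have hz : ∀ i : Fin (n + m), (⟨0, k.pos⟩ : Fin (n + m)) ≤ i := fun i => Nat.zero_le _
    have heq := (hcard _ (isInitialSeg_leFinset _) (isExchangeable_leFinset r hz)).trans
      (hcard₁ _ (isInitialSeg_leFinset _) (isExchangeable_leFinset r hz)).symm
    have hks : r + Finsupp.single k 1 ∈ leFinset (r + Finsupp.single ⟨0, k.pos⟩ 1) := by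
      rw [mem_leFinset]
      rcases (hz k).eq_or_lt with h | h
      · exact Or.inl (by rw [h])
      · exact Or.inr (revLt_add_single h r)
    -- If `r * x_k` were dependent only modulo `F₁`, the independent monomials for `F₁` would form a
    -- proper subset of those for `F`: below by induction, above by exchange. This contradicts the
    -- equal counts.
    have key : ∀ F F₁ : Ideal (MvPolynomial (Fin (n + m)) K),
        (∀ b, RevLt b (r + Finsupp.single k 1) → (GenDep F b ↔ GenDep F₁ b)) →
        ((leFinset (r + Finsupp.single ⟨0, k.pos⟩ 1)).filter fun a => ¬ GenDep F a).card =
          ((leFinset (r + Finsupp.single ⟨0, k.pos⟩ 1)).filter fun a => ¬ GenDep F₁ a).card →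
        GenDep F₁ (r + Finsupp.single k 1) → GenDep F (r + Finsupp.single k 1) := by
      intro F F₁ ih heq h₁
      by_contra hF
      refine heq.not_gt (Finset.card_lt_card ⟨fun b hb => ?_, fun hsub => ?_⟩)
      · rw [Finset.mem_filter] at hb ⊢
        refine ⟨hb.1, fun hFb => hb.2 ?_⟩
        have hdeg := (isInitialSeg_leFinset _).degree_eq b hb.1 _ hks
        rcases revLt_trichotomy hdeg with h | rfl | h
        · exact (ih b h).1 hFb
        · exact h₁
        · obtain ⟨j, hj, rfl⟩ := exists_lt_of_revLt_of_le hz hr h hb.1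
          exact h₁.exchange hj hr
      · have := hsub (Finset.mem_filter.2 ⟨hks, hF⟩)
        exact (Finset.mem_filter.1 this).2 h₁
    exact ⟨key _ _ (fun b hb => (ih b hb).symm) heq.symm, key _ _ ih heq⟩

end Fibre

/-! ### The main theorem -/

theorem theorem1p2 {K : Type*} [Field K] [CharZero K] (n m : ℕ)
    (I : Ideal (MvPolynomial (Fin n) K)) (J : Ideal (MvPolynomial (Fin m) K))
    (hI : I.IsHomogeneous (MvPolynomial.homogeneousSubmodule (Fin n) K))
    (hJ : J.IsHomogeneous (MvPolynomial.homogeneousSubmodule (Fin m) K)) :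
    IsGin I (gin I) ∧ IsGin J (gin J) ∧
      IsGin (fibreIdeal I J) (gin (fibreIdeal I J)) ∧
      IsGin (fibreIdeal (gin I) (gin J)) (gin (fibreIdeal (gin I) (gin J))) ∧
      gin (fibreIdeal I J) = gin (fibreIdeal (gin I) (gin J)) := by
  have hinf : Infinite K := inferInstance
  have hF := fibreIdeal_isHomogeneous hI hJ
  have hG := fibreIdeal_isHomogeneous (gin_isHomogeneous hI) (gin_isHomogeneous hJ)
  refine ⟨isGin_gin hI, isGin_gin hJ, isGin_gin hF, isGin_gin hG, ?_⟩
  -- The embedding into the product of quotients needs proper ideals; if a factor is the unit ideal,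
  -- so is its gin, and both fibre ideals are the unit ideal.
  by_cases hI' : I = ⊤
  · rw [hI', (gin_eq_top_iff (hI' ▸ hI)).2 rfl, fibreIdeal_top_left, fibreIdeal_top_left]
  by_cases hJ' : J = ⊤
  · rw [hJ', (gin_eq_top_iff (hJ' ▸ hJ)).2 rfl, fibreIdeal_top_right, fibreIdeal_top_right]
  rw [gin_eq hF, gin_eq hG]
  congr 1
  ext a
  exact genDep_fibreIdeal_congr hI hI' hJ hJ' (gin_isHomogeneous hI) (mt (gin_eq_top_iff hI).1 hI')
    (gin_isHomogeneous hJ) (mt (gin_eq_top_iff hJ).1 hJ') (fun a => (genDep_gin_iff hI a).symm)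
    (fun a => (genDep_gin_iff hJ a).symm) a
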